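/- Setting. Let $\mathcal G$ be an undirected graph with $n=m+u$ nodes ($m,u\ge1$), adjacency matrix $\mathbf A$, degree matrix $\mathbf D$ and $\tilde{\mathbf A}=(\mathbf D+\mathbf I)^{-1/2}(\mathbf A+\mathbf I)(\mathbf D+\mathbf I)^{-1/2}$; the nodes $z_i=(\mathbf x_i,y_i)$ carry features and labels in $\{1,\dots,K\}$. A graph neural network with learnable matrices $\mathbf W_1,\dots,\mathbf W_H$, collected in one vector $\mathbf w\in\mathbb R^d$, computes an $n\times K$ matrix of logits from the feature matrix $\mathbf X$ by finitely many of the operations $\mathbf Z\mapsto g(\tilde{\mathbf A})\mathbf Z$ (fixed filter $g$), $\mathbf Z\mapsto \mathbf Z\mathbf W_h$, multiplication by a fixed or a learnable scalar (an entry of some $\mathbf W_h$), addition, and entrywise application of an activation function $\sigma$ (this covers GCN, GCNII, SGC, APPNP and GPR-GNN). Let $\ell(\mathbf w;z_i)$ be the cross-entropy loss of the softmax prediction at node $i$, as a function of $\mathbf w$. For a permutation $\pi$ of the nodes put $R_m(\mathbf w)=\frac1m\sum_{i=1}^m\ell(\mathbf w;z_{\pi(i)})$ and $R_u(\mathbf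 w)=\frac1u\sum_{i=m+1}^{m+u}\ell(\mathbf w;z_{\pi(i)})$. SGD starts at $\mathbf w^{(1)}$ and sets $\mathbf w^{(t+1)}=\mathbf w^{(t)}-\eta_t\nabla\ell(\mathbf w^{(t)};z_{\pi(j_t)})$ for $1\le t\le T$, where $\pi$ is a uniformly random permutation and $j_1,\dots,j_T$ are uniform on $\{1,\dots,m\}$, all independent. Assumptions. Let $r\ge 1$, let $\mathcal W$ be the closed ball $B(\mathbf w^{(1)};r)$, let $\alpha\in(0,1]$ and let $c_X,c_W,P,G,\sigma_0>0$. (1) $\|\mathbf x_i\|_2\le c_X$ for all $i$. (2) The spectral norms satisfy $\|\mathbf W_h\|\le c_W$ for all $h$ and all $\mathbf w\in\mathcal W$, and the iterates $\mathbf w^{(1)},\dots,\mathbf w^{(T+1)}$ stay in $\mathcal W$. (3) $\sigma$ is differentiable and $|\sigma'(x)-\sigma'(y)|\le P|x-y|^{\alpha}$ for all $x,y\in\mathbb R$. (4) $\sqrt{\eta_t}\,\|\nabla\ell(\mathbf w^{(t)};z)\|_2\le G$ for all nodes $z$ and $1\le t\le T$. (5) For $1\le t\le T$ the next stochastic gradient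 has bounded mean norm, $\mathbb E_{j_t}\|\nabla\ell(\mathbf w^{(t)};z_{\pi(j_t)})\|_2\le\sigma_0^2$, or bounded variance, $\mathbb E_{j_t}\|\nabla\ell(\mathbf w^{(t)};z_{\pi(j_t)})-\nabla R_m(\mathbf w^{(t)})\|_2^2\le\sigma_0^2$. The assumptions on the iterates are required for every value of $\pi$ and of the draws. Notation. Let $b_g=\max_i\|\nabla\ell(\mathbf w^{(1)};z_i)\|_2$, $b_\ell=\max_i|\ell(\mathbf w^{(1)};z_i)|$, and let $P_{\mathcal F}$ be the smallest constant with $\|\nabla\ell(\mathbf w;z_i)-\nabla\ell(\mathbf w';z_i)\|_2\le P_{\mathcal F}\max\{\|\mathbf w-\mathbf w'\|_2^{\alpha},\|\mathbf w-\mathbf w'\|_2\}$ for all $i$ and $\mathbf w,\mathbf w'\in\mathcal W$. Theorem. Let $\eta_t=\frac1{t+t_0}$ with $t_0\ge1$ (in particular, $t_0\ge\max\{(2P)^{1/\alpha},1\}$ is allowed). Under (1)–(5) the constant $P_{\mathcal F}$ is finite, and there is a constant $C$, depending only on $d,\alpha,P_{\mathcal F},b_g,b_\ell,G,\sigma_0,t_0$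 (not on $m$, $u$, $T$, $\delta$, $r$), such that for every $T\ge2$ and every $\delta\in(0,1)$, with probability at least $1-\delta$ over $\pi$ and $j_1,\dots,j_T$, $$\left\|\nabla R_m(\mathbf w^{(T+1)})-\nabla R_u(\mathbf w^{(T+1)})\right\|_2\le C\,\frac{(m+u)^{3/2}}{mu}\,\rho_\alpha(T)\,\log\frac2\delta,$$ where (a) $\rho_\alpha(T)=\log^{1/2}(T)\,T^{\frac{1-2\alpha}2}$ if $\alpha\in(0,\frac12)$; (b) $\rho_\alpha(T)=\log T$ if $\alpha=\frac12$; (c) $\rho_\alpha(T)=\log^{1/2}(T)$ if $\alpha\in(\frac12,1]$. -/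

import Mathlib

/-!
Graph neural networks for transductive node classification, their cross-entropy objective,
and stochastic gradient descent on a uniformly random train / test split of the nodes.
-/

noncomputable section

namespace TransductiveGNN

/-- Layer expressions of a graph neural network on `n` nodes. The network has `H` learnable
matrices, the `h`-th one of shape `rows h × cols h`; the input features have dimension `p`.
An element of `Net n H rows cols p c` computes an `n × c` matrix of node representations.
GCN, GCNII, SGC, APPNP and GPR-GNN, with any number of layers, are all of this form. -/
inductive Net (n H : ℕ) (rows cols : Fin H → ℕ) (p : ℕ) : ℕ → Type
  /-- the feature matrix `X` -/
  | input : Net n H rows cols p p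
  /-- `Z ↦ g(Ã) Z`, with a fixed graph filter `g` -/
  | propagate {c : ℕ} (g : Matrix (Fin n) (Fin n) ℝ → Matrix (Fin n) (Fin n) ℝ)
      (Z : Net n H rows cols p c) : Net n H rows cols p c
  /-- `Z ↦ Z W_h` -/
  | linear (h : Fin H) (Z : Net n H rows cols p (rows h)) : Net n H rows cols p (cols h)
  /-- `Z ↦ a Z`, with a fixed real coefficient `a` -/
  | smul {c : ℕ} (a : ℝ) (Z : Net n H rows cols p c) : Net n H rows cols p c
  /-- `Z ↦ γ Z`, where the learnable coefficient `γ` is the `(i, j)` entry of `W_h` -/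
  | scale {c : ℕ} (h : Fin H) (i : Fin (rows h)) (j : Fin (cols h))
      (Z : Net n H rows cols p c) : Net n H rows cols p c
  /-- `(Z, Z') ↦ Z + Z'` -/
  | add {c : ℕ} (Z Z' : Net n H rows cols p c) : Net n H rows cols p c
  /-- `Z ↦ σ(Z)`, entrywise -/
  | act {c : ℕ} (Z : Net n H rows cols p c) : Net n H rows cols p c

/-- A node classification problem on an undirected graph with `n` nodes together with a GNN. -/
structure Problem (n : ℕ) where
  /-- the graph -/
  graph : SimpleGraph (Fin n)
  /-- the feature dimension -/
  p : ℕ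
  /-- the number of classes -/
  K : ℕ
  /-- the feature matrix, with one row per node -/
  X : Matrix (Fin n) (Fin p) ℝ
  /-- the labels of the nodes -/
  y : Fin n → Fin K
  /-- the number of learnable matrices -/
  H : ℕ
  /-- their numbers of rows -/
  rows : Fin H → ℕ
  /-- their numbers of columns -/
  cols : Fin H → ℕ
  /-- the activation function -/
  σ : ℝ → ℝ
  /-- the network that computes the `n × K` matrix of logits -/
  net : Net n H rows cols p K

namespace Problem

variable {n : ℕ} (F : Problem n)

/-- The index set of the entries of all learnable matrices. -/
abbrev Index : Type := Σ h : Fin F.H, Fin (F.rows h) × Fin (F.cols h)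

/-- The parameter vector `w`, the concatenation of all `vec W_h`, with the Euclidean norm. -/
abbrev Param : Type := EuclideanSpace ℝ F.Index

/-- The number of learnable real parameters. -/
def numParams : ℕ := ∑ h : Fin F.H, F.rows h * F.cols h

/-- The learnable matrix `W_h` in the parameter vector `w`. -/
def weight (w : F.Param) (h : Fin F.H) : Matrix (Fin (F.rows h)) (Fin (F.cols h)) ℝ :=
  Matrix.of fun i j => w ⟨h, (i, j)⟩

open Classical in
/-- The normalized adjacency matrix with self-loops,
`(D + I)^(-1/2) (A + I) (D + I)^(-1/2)`. -/
def normAdj : Matrix (Fin n) (Fin n) ℝ :=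
  Matrix.diagonal (fun i => (Real.sqrt ((F.graph.degree i : ℝ) + 1))⁻¹) *
    (F.graph.adjMatrix ℝ + 1) *
    Matrix.diagonal (fun i => (Real.sqrt ((F.graph.degree i : ℝ) + 1))⁻¹)

/-- The value of a layer expression at the parameter vector `w`. -/
def eval (w : F.Param) :
    {c : ℕ} → Net n F.H F.rows F.cols F.p c → Matrix (Fin n) (Fin c) ℝ
  | _, .input => F.X
  | _, .propagate g Z => g F.normAdj * eval w Z
  | _, .linear h Z => eval w Z * F.weight w h
  | _, .smul a Z => a • eval w Z
  | _, .scale h i j Z => F.weight w h i j • eval w Z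
  | _, .add Z Z' => eval w Z + eval w Z'
  | _, .act Z => (eval w Z).map F.σ

/-- The predicted probability of class `k` at node `i`: the softmax of the logits. -/
def predict (w : F.Param) (i : Fin n) (k : Fin F.K) : ℝ :=
  Real.exp (F.eval w F.net i k) / ∑ l : Fin F.K, Real.exp (F.eval w F.net i l)

/-- The cross-entropy loss `ℓ(w; z_i)` at node `i`. -/
def loss (i : Fin n) (w : F.Param) : ℝ := -Real.log (F.predict w i (F.y i))

/-- `b_g`, the largest norm of a loss gradient at the initial parameter. -/
def gradBound (w₁ : F.Param) : ℝ := ⨆ i : Fin n, ‖gradient (F.loss i) w₁‖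

/-- `b_ℓ`, the largest loss at the initial parameter. -/
def lossBound (w₁ : F.Param) : ℝ := ⨆ i : Fin n, |F.loss i w₁|

/-- `P₀` is an admissible `α`-Hölder smoothness constant of the objective on the ball
`B(w₁; r)`. -/
def IsHolderSmooth (α : ℝ) (w₁ : F.Param) (r P₀ : ℝ) : Prop :=
  0 ≤ P₀ ∧ ∀ i : Fin n, ∀ w ∈ Metric.closedBall w₁ r, ∀ w' ∈ Metric.closedBall w₁ r,
    ‖gradient (F.loss i) w - gradient (F.loss i) w'‖ ≤ P₀ * max (‖w - w'‖ ^ α) ‖w - w'‖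

/-- `P_F`, the smallest `α`-Hölder smoothness constant of the objective on `B(w₁; r)`. -/
def holderConst (α : ℝ) (w₁ : F.Param) (r : ℝ) : ℝ := sInf {P₀ | F.IsHolderSmooth α w₁ r P₀}

/-- The features are bounded by `cX`. -/
def BoundedFeatures (cX : ℝ) : Prop := ∀ i : Fin n, ‖WithLp.toLp 2 (F.X i)‖ ≤ cX

open scoped Matrix.Norms.L2Operator in
/-- The spectral norms of all learnable matrices are at most `cW` on the ball `B(w₁; r)`. -/
def BoundedWeights (w₁ : F.Param) (r cW : ℝ) : Prop :=
  ∀ w ∈ Metric.closedBall w₁ r, ∀ h : Fin F.H, ‖F.weight w h‖ ≤ cW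

/-- The activation function is `α`-Hölder smooth with constant `P`. -/
def HolderActivation (α P : ℝ) : Prop :=
  Differentiable ℝ F.σ ∧ ∀ x y : ℝ, |deriv F.σ x - deriv F.σ y| ≤ P * |x - y| ^ α

end Problem

section Split

variable {m u : ℕ} (F : Problem (m + u))

/-- The training error: the nodes `π 1, …, π m` carry the observed labels. -/
def trainRisk (π : Equiv.Perm (Fin (m + u))) (w : F.Param) : ℝ :=
  (1 / m) * ∑ i : Fin m, F.loss (π (Fin.castAdd u i)) w

/-- The test error: the average over the nodes `π (m + 1), …, π (m + u)`. -/
def testRisk (π : Equiv.Perm (Fin (m + u))) (w : F.Param) : ℝ :=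
  (1 / u) * ∑ i : Fin u, F.loss (π (Fin.natAdd m i)) w

/-- The stochastic gradient at `w` for the training node number `j`. -/
def stochGrad (π : Equiv.Perm (Fin (m + u))) (w : F.Param) (j : Fin m) : F.Param :=
  gradient (F.loss (π (Fin.castAdd u j))) w

/-- Stochastic gradient descent: `sgd F η w₁ π t j` is the iterate `w^(t+1)` obtained from
`w^(1) = w₁` with the `t` draws `j` (the `k`-th draw is `j ⟨k - 1, _⟩`), that is,
`w^(t+1) = w^(t) - η_t ∇ℓ(w^(t); z_(j_t))`. -/
def sgd (η : ℕ → ℝ) (w₁ : F.Param) (π : Equiv.Perm (Fin (m + u))) :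
    (t : ℕ) → (Fin t → Fin m) → F.Param
  | 0, _ => w₁
  | t + 1, j =>
      sgd η w₁ π t (Fin.init j) -
        η (t + 1) • stochGrad F π (sgd η w₁ π t (Fin.init j)) (j (Fin.last t))

/-- The iterates `w^(1), …, w^(T+1)` stay in the parameter space `B(w₁; r)`, whatever the split
and the draws are. -/
def StaysIn (η : ℕ → ℝ) (w₁ : F.Param) (r : ℝ) (T : ℕ) : Prop :=
  ∀ (π : Equiv.Perm (Fin (m + u))) (t : ℕ), t ≤ T → ∀ j : Fin t → Fin m,
    sgd F η w₁ π t j ∈ Metric.closedBall w₁ r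

/-- `√η_t ‖∇ℓ(w^(t); z)‖ ≤ G` for all nodes `z` and `t = 1, …, T`, along every trajectory. -/
def BoundedGradients (η : ℕ → ℝ) (w₁ : F.Param) (T : ℕ) (G : ℝ) : Prop :=
  ∀ (π : Equiv.Perm (Fin (m + u))) (t : ℕ), t < T → ∀ (j : Fin t → Fin m) (i : Fin (m + u)),
    Real.sqrt (η (t + 1)) * ‖gradient (F.loss i) (sgd F η w₁ π t j)‖ ≤ G

/-- The moment condition on the stochastic gradients for `t = 1, …, T` along every trajectory,
with the expectation over the next uniform draw. It admits both usual forms, the bound on the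
mean norm and the bound on the variance. -/
def BoundedNoise (η : ℕ → ℝ) (w₁ : F.Param) (T : ℕ) (σ₀ : ℝ) : Prop :=
  ∀ (π : Equiv.Perm (Fin (m + u))) (t : ℕ), t < T → ∀ j : Fin t → Fin m,
    (1 / m) * ∑ i : Fin m, ‖stochGrad F π (sgd F η w₁ π t j) i‖ ≤ σ₀ ^ 2 ∨
    (1 / m) * ∑ i : Fin m, ‖stochGrad F π (sgd F η w₁ π t j) i -
      gradient (trainRisk F π) (sgd F η w₁ π t j)‖ ^ 2 ≤ σ₀ ^ 2

/-- The random outcome of a run of `T` steps: the split `π` and the draws `j_1, …, j_T`. -/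
abbrev Outcome (m u T : ℕ) : Type := Equiv.Perm (Fin (m + u)) × (Fin T → Fin m)

/-- The probability of an event when the outcome is uniformly distributed, that is, when `π` is a
uniformly random permutation and the draws are uniform on the training nodes, all independent. -/
def prob (m u T : ℕ) (E : Outcome m u T → Prop) : ℝ :=
  (Nat.card {ω : Outcome m u T // E ω} : ℝ) / (Nat.card (Outcome m u T) : ℝ)

/-- The gradient gap `‖∇R_m(w^(T+1)) - ∇R_u(w^(T+1))‖`. -/
def gradGap (η : ℕ → ℝ) (w₁ : F.Param) {T : ℕ} (ω : Outcome m u T) : ℝ :=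
  ‖gradient (trainRisk F ω.1) (sgd F η w₁ ω.1 T ω.2) -
    gradient (testRisk F ω.1) (sgd F η w₁ ω.1 T ω.2)‖

end Split

/-- The dependence of the bound on the number `T` of iterations in the three regimes of `α`. -/
def rate (α : ℝ) (T : ℕ) : ℝ :=
  if α < 1 / 2 then Real.sqrt (Real.log T) * (T : ℝ) ^ ((1 - 2 * α) / 2)
  else if α = 1 / 2 then Real.log T
  else Real.sqrt (Real.log T)

end TransductiveGNN

end

/-!
For a fixed parameter `w`, the vector `∇R_m(w) - ∇R_u(w)` is a linear statistic of the random
permutation `π`, with coefficients `1 / m` and `-1 / u` that sum to zero. Revealing `π` value by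
value (`expect_perm_exp_le`) shows that each of its coordinates is sub-Gaussian at the scale
`(m + u)^(3/2) / (m u)` times a bound for the gradients of the losses. The iterate
`w^(T+1)` depends on `π`, so this is made uniform over a ball around `w^(1)` by chaining along dyadic
nets (`pr_exists_splitGap_gt`): the increments are `α`-Hölder with constant `P_F`, so the entropy
sum converges, no logarithm of `m + u` is lost, and the supremum over a ball of radius `R ≥ 1` is
of order `R √log(2/δ)`.

It remains to see that with probability `1 - δ / 2` the iterates travel at most a distance
`R ≍ √(log T · log(2/δ))`, whatever `π` is (`pr_norm_sgd_sub_gt`). Split the displacement into the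
drift `∑ η_t ∇R_m(w^(t))` and a martingale. The increments of the martingale are bounded by a
multiple of `√η_t G`, and `∑ η_t ≤ 2 log T`, so that an Azuma bound in each coordinate suffices
(`pr_martingale_ge`). By Cauchy–Schwarz the squared norm of the drift is at most `∑ η_t` times the
energy `∑ η_t ‖∇R_m(w^(t))‖²`, and the energy is of order `log(2/δ)` (`pr_energy_ge`): by the descent
inequality, the training risk plus half of the energy, minus a multiple of the convergent series
`∑ η_t^(1 + α/2)`, has an exponential moment that does not grow. The two moment conditions on the
stochastic gradients serve only to bound the mean of the remainder in the descent inequality.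

Together these give a bound with `√(log T)` for every `α`, and each of the three rates dominates
`√(log T)` up to a constant (`sqrt_log_le_rate`).

The existence of `P_F` is calculus: logits, and hence losses, are built by sums, products and
compositions, which preserve continuous differentiability with a derivative that is `α`-Hölder on
balls (`HolderC1`).
-/

namespace TransductiveGNN

open scoped BigOperators
open Finset

/-! ### Finite averages and exponential moments -/

/-- Hoeffding's lemma for the uniform distribution on a finite type, by symmetrization: Jensen's
inequality brings in an independent copy, and the difference has the moment function `cosh`. -/
theorem expect_exp_le_of_oscillation {ι : Type*} [Fintype ι] [Nonempty ι] (f : ι → ℝ) (c : ℝ)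
    (hf : ∀ i k, |f i - f k| ≤ c) :
    𝔼 i, Real.exp (f i) ≤ Real.exp (𝔼 i, f i + c ^ 2 / 2) := by
  have hN : (0 : ℝ) < Fintype.card ι := by exact_mod_cast Fintype.card_pos
  have jensen : Real.exp (-𝔼 k, f k) ≤ 𝔼 k, Real.exp (-f k) := by
    have := convexOn_exp.map_sum_le (t := (univ : Finset ι)) (w := fun _ => (Fintype.card ι : ℝ)⁻¹)
      (p := fun k => -f k) (fun _ _ => by positivity) (by simp [hN.ne']) (by simp)
    simpa [Fintype.expect_eq_sum_div_card, div_eq_inv_mul, mul_sum] using this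
  have sym : (𝔼 i, Real.exp (f i)) * 𝔼 k, Real.exp (-f k) ≤ Real.exp (c ^ 2 / 2) := by
    have h1 : (𝔼 i, Real.exp (f i)) * 𝔼 k, Real.exp (-f k) =
        𝔼 i, 𝔼 k, Real.exp (f i - f k) := by
      rw [expect_mul_expect]
      simp [sub_eq_add_neg, Real.exp_add]
    have h2 : 𝔼 i, 𝔼 k, Real.exp (f i - f k) = 𝔼 i, 𝔼 k, Real.cosh (f i - f k) := by
      have h3 : 𝔼 i, 𝔼 k, Real.exp (f i - f k) = 𝔼 i, 𝔼 k, Real.exp (-(f i - f k)) := by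
        rw [expect_comm]; simp
      have h4 : 𝔼 i, 𝔼 k, Real.cosh (f i - f k) =
          (𝔼 i, 𝔼 k, Real.exp (f i - f k) + 𝔼 i, 𝔼 k, Real.exp (-(f i - f k))) / 2 := by
        simp_rw [Real.cosh_eq, ← expect_div, expect_add_distrib]
      rw [h4, ← h3]; ring
    rw [h1, h2]
    refine expect_le univ_nonempty fun i _ => expect_le univ_nonempty fun k _ => ?_
    refine (Real.cosh_le_exp_half_sq _).trans (Real.exp_le_exp.2 ?_)
    have := sq_le_sq' (by linarith [abs_nonneg (f i - f k), hf i k, neg_abs_le (f i - f k)])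
      ((le_abs_self _).trans (hf i k))
    linarith
  have hpos : 0 ≤ 𝔼 i, Real.exp (f i) := expect_nonneg fun i _ => (Real.exp_pos _).le
  have h5 := (mul_le_mul_of_nonneg_left jensen hpos).trans sym
  rw [Real.exp_neg, ← div_eq_mul_inv, div_le_iff₀ (Real.exp_pos _)] at h5
  rw [add_comm, Real.exp_add]
  exact h5

/-- The mean over the value `x p` drawn first of the conditional mean of a linear statistic with
first coefficient `c` and remaining coefficients of sum `C`. For `n = 0` the division by zero is
harmless because `C = 0`. -/
theorem expect_linear_eq {n : ℕ} (S : ℝ) (x : Fin (n + 1) → ℝ) (c C : ℝ) (hS : ∑ i, x i = S)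
    (hC : n = 0 → C = 0) :
    𝔼 p, (c * x p + C * (S - x p) / n) = (c + C) * S / ((n + 1 : ℕ) : ℝ) := by
  rw [expect_add_distrib, ← mul_expect, ← expect_div, ← mul_expect, expect_sub_distrib,
    Fintype.expect_const, Fintype.expect_eq_sum_div_card, hS, Fintype.card_fin]
  rcases Nat.eq_zero_or_pos n with h | h
  · simp [hC h, mul_div_assoc]
  · have : (n : ℝ) ≠ 0 := by positivity
    push_cast
    field_simp
    ring

/-- Exponential moments of a linear statistic of a uniformly random permutation, by revealing the
values one at a time: given `π 0 = p`, the other values are a uniformly random arrangement of the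
remaining entries of `x`, and the conditional mean oscillates by at most `4 A L` in `p`. -/
theorem expect_perm_exp_le : ∀ (n : ℕ) (c x : Fin n → ℝ) (A L : ℝ), (∀ k, |c k| ≤ A) →
    (∀ k, |x k| ≤ L) →
    𝔼 π : Equiv.Perm (Fin n), Real.exp (∑ k, c k * x (π k)) ≤
      Real.exp ((∑ k, c k) * (∑ k, x k) / n + n * ((4 * A * L) ^ 2 / 2))
  | 0, c, x, A, L, _, _ => by simp
  | n + 1, c, x, A, L, hc, hx => by
    have hA : 0 ≤ A := (abs_nonneg _).trans (hc 0)
    have hL : 0 ≤ L := (abs_nonneg _).trans (hx 0)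
    set C := ∑ k : Fin n, c k.succ with hCdef
    set S := ∑ k, x k with hSdef
    have hsum : ∀ p : Fin (n + 1), ∑ l : Fin n, x (Equiv.swap 0 p l.succ) = S - x p := by
      intro p
      have h1 : ∑ l, x (Equiv.swap 0 p l) = S := Equiv.sum_comp (Equiv.swap 0 p) x
      rw [Fin.sum_univ_succ, Equiv.swap_apply_left] at h1
      linarith
    have hCbd : |C| ≤ n * A := by
      refine (abs_sum_le_sum_abs _ _).trans ((sum_le_sum fun k _ => hc _).trans ?_)
      simp
    have hCn : |C / n| ≤ A := by
      rcases Nat.eq_zero_or_pos n with h | h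
      · simp [h, hA]
      · have : (0 : ℝ) < n := by positivity
        rw [abs_div, abs_of_pos this, div_le_iff₀ this]; linarith
    have hosc : ∀ p q : Fin (n + 1), |(c 0 * x p + C * (S - x p) / n) -
        (c 0 * x q + C * (S - x q) / n)| ≤ 4 * A * L := by
      intro p q
      have h1 : (c 0 * x p + C * (S - x p) / n) - (c 0 * x q + C * (S - x q) / n) =
          (c 0 - C / n) * (x p - x q) := by ring
      rw [h1, abs_mul]
      have h2 : |c 0 - C / n| ≤ 2 * A := (abs_sub _ _).trans (by linarith [hc 0])
      have h3 : |x p - x q| ≤ 2 * L := (abs_sub _ _).trans (by linarith [hx p, hx q])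
      calc _ ≤ (2 * A) * (2 * L) := mul_le_mul h2 h3 (abs_nonneg _) (by linarith)
        _ = _ := by ring
    calc 𝔼 π : Equiv.Perm (Fin (n + 1)), Real.exp (∑ k, c k * x (π k))
        = 𝔼 pe : Fin (n + 1) × Equiv.Perm (Fin n), Real.exp (c 0 * x pe.1 +
            ∑ k : Fin n, c k.succ * x (Equiv.swap 0 pe.1 (pe.2 k).succ)) := by
          refine Fintype.expect_equiv Equiv.Perm.decomposeFin _ _ fun π => ?_
          obtain ⟨⟨p, e⟩, rfl⟩ := Equiv.Perm.decomposeFin.symm.surjective π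
          simp [Fin.sum_univ_succ]
      _ = 𝔼 p : Fin (n + 1), Real.exp (c 0 * x p) * 𝔼 e : Equiv.Perm (Fin n),
            Real.exp (∑ k : Fin n, c k.succ * x (Equiv.swap 0 p (e k).succ)) := by
          rw [← univ_product_univ, expect_product]
          simp [Real.exp_add, mul_expect]
      _ ≤ 𝔼 p : Fin (n + 1), Real.exp (c 0 * x p) *
            Real.exp (C * (S - x p) / n + n * ((4 * A * L) ^ 2 / 2)) := by
          refine expect_le_expect fun p _ => mul_le_mul_of_nonneg_left ?_ (Real.exp_pos _).le
          have := expect_perm_exp_le n (fun k => c k.succ) (fun l => x (Equiv.swap 0 p l.succ)) A L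
            (fun k => hc _) (fun k => hx _)
          rwa [hsum] at this
      _ = (𝔼 p : Fin (n + 1), Real.exp (c 0 * x p + C * (S - x p) / n)) *
            Real.exp (n * ((4 * A * L) ^ 2 / 2)) := by
          rw [expect_mul]
          refine expect_congr rfl fun p _ => ?_
          rw [← Real.exp_add, ← Real.exp_add]; congr 1; ring
      _ ≤ Real.exp ((c 0 + C) * S / ((n + 1 : ℕ) : ℝ) + (4 * A * L) ^ 2 / 2) *
            Real.exp (n * ((4 * A * L) ^ 2 / 2)) := by
          refine mul_le_mul_of_nonneg_right ?_ (Real.exp_pos _).le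
          rw [← expect_linear_eq S x (c 0) C rfl]
          · exact expect_exp_le_of_oscillation _ _ hosc
          · rintro rfl; simp [hCdef]
      _ = _ := by
          rw [← Real.exp_add, Fin.sum_univ_succ]
          congr 1
          push_cast
          ring

/-- Supermartingale principle for uniform draws: if no step increases the conditional exponential
moment of `V`, then the exponential moment of `V T` is at most the initial one. -/
theorem expect_exp_le_of_step {m : ℕ} [NeZero m] (V : (t : ℕ) → (Fin t → Fin m) → ℝ) (T : ℕ)
    (hstep : ∀ t < T, ∀ j : Fin t → Fin m,
      𝔼 i : Fin m, Real.exp (V (t + 1) (Fin.snoc j i)) ≤ Real.exp (V t j)) :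
    𝔼 j, Real.exp (V T j) ≤ Real.exp (V 0 Fin.elim0) := by
  induction T with
  | zero =>
    refine expect_le univ_nonempty fun j _ => ?_
    rw [Subsingleton.elim j Fin.elim0]
  | succ T ih =>
    refine le_trans ?_ (ih fun t ht => hstep t (by omega))
    calc 𝔼 j : Fin (T + 1) → Fin m, Real.exp (V (T + 1) j)
        = 𝔼 ij : Fin m × (Fin T → Fin m), Real.exp (V (T + 1) (Fin.snoc ij.2 ij.1)) := by
          symm
          exact Fintype.expect_equiv (Fin.snocEquiv fun _ => Fin m) _ _ fun π => rfl
      _ = 𝔼 j : Fin T → Fin m, 𝔼 i : Fin m, Real.exp (V (T + 1) (Fin.snoc j i)) := by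
          rw [← univ_product_univ, expect_product, expect_comm]
      _ ≤ _ := expect_le_expect fun j _ => hstep T (by omega) j

open Classical in
/-- The probability of an event under the uniform distribution on a finite type. -/
noncomputable def pr {Ω : Type*} [Fintype Ω] (p : Ω → Prop) : ℝ := 𝔼 ω, if p ω then 1 else 0

theorem pr_mono {Ω : Type*} [Fintype Ω] {p q : Ω → Prop} (h : ∀ ω, p ω → q ω) : pr p ≤ pr q := by
  classical
  refine expect_le_expect fun ω _ => ?_
  by_cases hp : p ω
  · simp [hp, h ω hp]
  · simp only [hp, if_false]; split_ifs <;> norm_num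

theorem pr_or_le {Ω : Type*} [Fintype Ω] (p q : Ω → Prop) : pr (fun ω => p ω ∨ q ω) ≤ pr p + pr q := by
  classical
  unfold pr
  rw [← expect_add_distrib]
  refine expect_le_expect fun ω _ => ?_
  by_cases hp : p ω <;> by_cases hq : q ω <;> simp [hp, hq]

theorem pr_exists_le {Ω ι : Type*} [Fintype Ω] (s : Finset ι) (p : ι → Ω → Prop) :
    pr (fun ω => ∃ i ∈ s, p i ω) ≤ ∑ i ∈ s, pr (p i) := by
  classical
  unfold pr
  rw [← expect_sum_comm]
  refine expect_le_expect fun ω _ => ?_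
  split_ifs with h
  · obtain ⟨i, hi, hp⟩ := h
    have := single_le_sum (f := fun i => if p i ω then (1 : ℝ) else 0)
      (fun k _ => by split_ifs <;> norm_num) hi
    simpa [hp] using this
  · exact sum_nonneg fun k _ => by split_ifs <;> norm_num

/-- Markov's inequality for the exponential. -/
theorem pr_le_of_expect_exp_le {Ω : Type*} [Fintype Ω] (f : Ω → ℝ) (x K : ℝ)
    (hf : 𝔼 ω, Real.exp (f ω) ≤ Real.exp K) : pr (fun ω => x ≤ f ω) ≤ Real.exp (K - x) := by
  classical
  have h1 : pr (fun ω => x ≤ f ω) ≤ 𝔼 ω, Real.exp (f ω) * Real.exp (-x) := by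
    refine expect_le_expect fun ω _ => ?_
    split_ifs with h
    · rw [← Real.exp_add]; exact Real.one_le_exp (by linarith)
    · positivity
  rw [← expect_mul] at h1
  refine h1.trans ?_
  rw [sub_eq_add_neg, Real.exp_add]
  exact mul_le_mul_of_nonneg_right hf (Real.exp_pos _).le

theorem pr_prod_le {Ω Ω' : Type*} [Fintype Ω] [Fintype Ω'] [Nonempty Ω] (p : Ω × Ω' → Prop) (ε : ℝ)
    (h : ∀ π, pr (fun j => p (π, j)) ≤ ε) : pr p ≤ ε := by
  classical
  unfold pr
  rw [← univ_product_univ, expect_product]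
  exact expect_le univ_nonempty fun π _ => h π

theorem pr_comp_fst_le {Ω Ω' : Type*} [Fintype Ω] [Fintype Ω'] [Nonempty Ω'] (p : Ω → Prop) :
    pr (fun ω : Ω × Ω' => p ω.1) ≤ pr p := by
  classical
  unfold pr
  rw [← univ_product_univ, expect_product]
  exact expect_le_expect fun ω _ => expect_le univ_nonempty fun _ _ => le_rfl

theorem one_sub_le_prob {m u T : ℕ} (hm : 1 ≤ m) (E : Outcome m u T → Prop) (δ : ℝ)
    (h : pr (fun ω => ¬ E ω) ≤ δ) : 1 - δ ≤ prob m u T E := by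
  classical
  have : NeZero m := ⟨by omega⟩
  have h1 : prob m u T E = 𝔼 ω : Outcome m u T, if E ω then (1 : ℝ) else 0 := by
    rw [Fintype.expect_eq_sum_div_card, prob, Nat.card_eq_fintype_card, Nat.card_eq_fintype_card,
      Fintype.card_subtype]
    simp
  have h2 : 𝔼 ω : Outcome m u T, ((if E ω then (1 : ℝ) else 0) + if ¬ E ω then 1 else 0) = 1 := by
    rw [← Fintype.expect_one (ι := Outcome m u T) (M := ℝ)]
    refine expect_congr rfl fun ω _ => ?_
    by_cases hE : E ω <;> simp [hE]
  rw [expect_add_distrib, ← h1] at h2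
  have h3 : pr (fun ω => ¬ E ω) = 𝔼 ω : Outcome m u T, if ¬ E ω then (1 : ℝ) else 0 := by
    unfold pr; congr!
  linarith

/-! ### Dyadic nets of balls -/

/-- Covering by balls of half the radius with centres in `S`, of a number that depends only on the
dimension: take a maximal separated subset. -/
theorem exists_half_net {E : Type*} [NormedAddCommGroup E] [NormedSpace ℝ E]
    [FiniteDimensional ℝ E] (S : Set E) (c : E) {r : ℝ} (hr : 0 < r) :
    ∃ N : Finset E, N.card ≤ 5 ^ Module.finrank ℝ E ∧
      (∀ y ∈ N, y ∈ S ∧ ‖y - c‖ ≤ r) ∧ ∀ x ∈ S, ‖x - c‖ ≤ r → ∃ y ∈ N, ‖x - y‖ ≤ r / 2 := by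
  classical
  let Sep : Finset E → Prop := fun N => (∀ y ∈ N, y ∈ S ∧ ‖y - c‖ ≤ r) ∧
    ∀ x ∈ N, ∀ y ∈ N, x ≠ y → r / 2 ≤ ‖x - y‖
  have hcard : ∀ N, Sep N → N.card ≤ 5 ^ Module.finrank ℝ E := by
    intro N hN
    have hinj : Function.Injective fun y : E => (2 / r) • (y - c) := by
      intro x y hxy
      have h0 : (2 / r : ℝ) ≠ 0 := by positivity
      simpa using smul_right_injective E h0 hxy
    have h2 : ‖(2 / r : ℝ)‖ = 2 / r := by rw [Real.norm_of_nonneg]; positivity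
    rw [← card_image_of_injective N hinj]
    refine Besicovitch.card_le_of_separated _ ?_ ?_
    · intro z hz
      obtain ⟨y, hy, rfl⟩ := mem_image.1 hz
      rw [norm_smul, h2]
      calc 2 / r * ‖y - c‖ ≤ 2 / r * r := by gcongr; exact (hN.1 y hy).2
        _ = 2 := by field_simp
    · intro z hz z' hz' hne
      obtain ⟨y, hy, rfl⟩ := mem_image.1 hz
      obtain ⟨y', hy', rfl⟩ := mem_image.1 hz'
      have hyy : y ≠ y' := fun h => hne (by rw [h])
      rw [← smul_sub, sub_sub_sub_cancel_right, norm_smul, h2]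
      calc (1 : ℝ) = 2 / r * (r / 2) := by field_simp
        _ ≤ _ := by gcongr; exact hN.2 y hy y' hy' hyy
  -- a separated set of maximal cardinality is a net, since any uncovered point could be added
  let Q : ℕ → Prop := fun k => ∃ N, Sep N ∧ N.card = k
  have hQ0 : Q 0 := ⟨∅, by simp [Sep], rfl⟩
  obtain ⟨N, hN, hNk⟩ := Nat.findGreatest_spec (P := Q) (Nat.zero_le (5 ^ Module.finrank ℝ E)) hQ0
  refine ⟨N, hcard N hN, hN.1, fun x hx hxr => ?_⟩
  by_contra hcon
  push Not at hcon
  have hxN : x ∉ N := fun h => by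
    have := hcon x h
    simp at this
    linarith
  have hSep : Sep (insert x N) := by
    refine ⟨fun y hy => ?_, fun y hy z hz hyz => ?_⟩
    · rcases mem_insert.1 hy with rfl | h
      · exact ⟨hx, hxr⟩
      · exact hN.1 y h
    · rcases mem_insert.1 hy with rfl | h <;> rcases mem_insert.1 hz with rfl | h'
      · exact absurd rfl hyz
      · exact (hcon z h').le
      · rw [norm_sub_rev]; exact (hcon y h).le
      · exact hN.2 y h z h' hyz
  have h1 := Nat.le_findGreatest (P := Q) (hcard _ hSep) ⟨_, hSep, rfl⟩
  rw [card_insert_of_notMem hxN, ← hNk] at h1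
  omega

/-- A dyadic system of nets of a ball, given by its links: `N k` consists of the pairs (child, parent)
with a parent of level `k` and a child of level `k + 1`. Every point of the ball is approached by
a chain `p` of links that starts at the centre. -/
theorem exists_dyadic_nets {E : Type*} [NormedAddCommGroup E] [NormedSpace ℝ E]
    [FiniteDimensional ℝ E] (c : E) {ρ : ℝ} (hρ : 0 < ρ) :
    ∃ N : ℕ → Finset (E × E), (∀ k, (N k).card ≤ (5 ^ Module.finrank ℝ E) ^ (k + 1)) ∧
      (∀ k, ∀ q ∈ N k, ‖q.1 - c‖ ≤ ρ ∧ ‖q.2 - c‖ ≤ ρ ∧ ‖q.1 - q.2‖ ≤ ρ / 2 ^ k) ∧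
      ∀ x, ‖x - c‖ ≤ ρ → ∃ p : ℕ → E, p 0 = c ∧ (∀ k, (p (k + 1), p k) ∈ N k) ∧
        (∀ k, ‖p k - c‖ ≤ ρ) ∧ ∀ k, ‖x - p k‖ ≤ ρ / 2 ^ k := by
  classical
  have hnet := fun (k : ℕ) (y : E) => exists_half_net {z : E | ‖z - c‖ ≤ ρ} y
    (r := ρ / 2 ^ k) (by positivity)
  choose M hMcard hMmem hMnet using hnet
  let A : ℕ → Finset E := fun k => Nat.rec {c} (fun k S => S.biUnion (M k)) k
  have hA1 : ∀ k, A (k + 1) = (A k).biUnion (M k) := fun k => rfl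
  have hAcard : ∀ k, (A k).card ≤ (5 ^ Module.finrank ℝ E) ^ k := by
    intro k
    induction k with
    | zero => simp [A]
    | succ k ih =>
      rw [hA1, pow_succ]
      exact (card_biUnion_le_card_mul _ _ _ fun y _ => hMcard k y).trans
        (Nat.mul_le_mul_right _ ih)
  have hAmem : ∀ k, ∀ y ∈ A k, ‖y - c‖ ≤ ρ := by
    intro k
    cases k with
    | zero => intro y hy; simp [mem_singleton.1 (show y ∈ {c} from hy), hρ.le]
    | succ k =>
      intro y hy
      rw [hA1, mem_biUnion] at hy
      obtain ⟨z, _, hz⟩ := hy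
      exact (hMmem k z y hz).1
  refine ⟨fun k => (A k).biUnion fun y => (M k y).image fun z => (z, y), fun k => ?_, ?_, ?_⟩
  · rw [pow_succ]
    exact (card_biUnion_le_card_mul _ _ _ fun y _ => card_image_le.trans (hMcard k y)).trans
        (Nat.mul_le_mul_right _ (hAcard k))
  · intro k q hq
    obtain ⟨y, hy, hq⟩ := mem_biUnion.1 hq
    obtain ⟨z, hz, rfl⟩ := mem_image.1 hq
    exact ⟨(hMmem k y z hz).1, hAmem k y hy, (hMmem k y z hz).2⟩
  · intro x hx
    have hnext : ∀ (k : ℕ) (y : {y // y ∈ A k ∧ ‖x - y‖ ≤ ρ / 2 ^ k}),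
        ∃ z : {z // z ∈ A (k + 1) ∧ ‖x - z‖ ≤ ρ / 2 ^ (k + 1)}, z.1 ∈ M k y.1 := by
      rintro k ⟨y, hy, hxy⟩
      obtain ⟨z, hz, hxz⟩ := hMnet k y x hx hxy
      refine ⟨⟨z, ?_, ?_⟩, hz⟩
      · rw [hA1]; exact mem_biUnion.2 ⟨y, hy, hz⟩
      · rwa [pow_succ, ← div_div]
    choose nxt hnxt using hnext
    let p : (k : ℕ) → {y // y ∈ A k ∧ ‖x - y‖ ≤ ρ / 2 ^ k} :=
      fun k => Nat.rec ⟨c, by simp [A], by simpa using hx⟩ (fun k y => nxt k y) k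
    refine ⟨fun k => (p k).1, rfl, fun k => ?_, fun k => hAmem k _ (p k).2.1, fun k => (p k).2.2⟩
    exact mem_biUnion.2 ⟨(p k).1, (p k).2.1, mem_image.2 ⟨_, hnxt k (p k), rfl⟩⟩

/-! ### Uniform concentration over a ball by chaining -/

/-- The scale `(m + u)^(3/2) / (m u)` of the deviations. -/
noncomputable def splitScale (m u : ℕ) : ℝ := ((m : ℝ) + u) ^ (3 / 2 : ℝ) / ((m : ℝ) * u)

theorem splitScale_pos {m u : ℕ} (hm : 1 ≤ m) (hu : 1 ≤ u) : 0 < splitScale m u := by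
  have : (0 : ℝ) < m := by exact_mod_cast hm
  have : (0 : ℝ) < u := by exact_mod_cast hu
  unfold splitScale
  positivity

theorem splitScale_sq {m u : ℕ} (hm : 1 ≤ m) (hu : 1 ≤ u) :
    splitScale m u ^ 2 = ((m + u : ℕ) : ℝ) * (1 / (m : ℝ) + 1 / u) ^ 2 := by
  have hm' : (0 : ℝ) < m := by exact_mod_cast hm
  have hu' : (0 : ℝ) < u := by exact_mod_cast hu
  have h : (((m : ℝ) + u) ^ (3 / 2 : ℝ)) ^ 2 = ((m : ℝ) + u) ^ 3 := by
    rw [← Real.rpow_natCast, ← Real.rpow_mul (by positivity)]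
    norm_num
  rw [splitScale, div_pow, h]
  push_cast
  field_simp
  ring

/-- The average of `X` over the training nodes minus its average over the test nodes. -/
noncomputable def splitGap {m u : ℕ} {V : Type*} [AddCommGroup V] [Module ℝ V]
    (π : Equiv.Perm (Fin (m + u))) (X : Fin (m + u) → V) : V :=
  (1 / (m : ℝ)) • ∑ i : Fin m, X (π (Fin.castAdd u i)) -
    (1 / (u : ℝ)) • ∑ i : Fin u, X (π (Fin.natAdd m i))

theorem splitGap_sub {m u : ℕ} {V : Type*} [AddCommGroup V] [Module ℝ V]
    (π : Equiv.Perm (Fin (m + u))) (X Y : Fin (m + u) → V) :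
    splitGap π (X - Y) = splitGap π X - splitGap π Y := by
  simp only [splitGap, Pi.sub_apply, sum_sub_distrib, smul_sub]
  abel

theorem splitGap_norm_le {m u : ℕ} (hm : 1 ≤ m) (hu : 1 ≤ u) {V : Type*} [NormedAddCommGroup V]
    [NormedSpace ℝ V] (π : Equiv.Perm (Fin (m + u))) (X : Fin (m + u) → V) (L : ℝ)
    (hX : ∀ i, ‖X i‖ ≤ L) : ‖splitGap π X‖ ≤ 2 * L := by
  have avg : ∀ (k : ℕ), 1 ≤ k → ∀ Y : Fin k → V, (∀ i, ‖Y i‖ ≤ L) →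
      ‖(1 / (k : ℝ)) • ∑ i, Y i‖ ≤ L := by
    intro k hk Y hY
    have hk' : (0 : ℝ) < k := by exact_mod_cast hk
    rw [norm_smul, Real.norm_of_nonneg (by positivity), one_div, inv_mul_le_iff₀ hk']
    exact (norm_sum_le _ _).trans ((sum_le_sum fun i _ => hY i).trans (by simp))
  refine (norm_sub_le _ _).trans ?_
  linarith [avg m hm _ fun i => hX (π (Fin.castAdd u i)), avg u hu _ fun i => hX (π (Fin.natAdd m i))]

/-- A tail bound for the gap of a scalar function on the nodes. The coefficients of the linear
statistic sum to zero, so its mean vanishes. -/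
theorem pr_splitGap_ge {m u : ℕ} (hm : 1 ≤ m) (hu : 1 ≤ u) (x : Fin (m + u) → ℝ) {L v : ℝ}
    (hL : 0 < L) (hv : 0 ≤ v) (hx : ∀ i, |x i| ≤ L) :
    pr (fun π => 9 * splitScale m u * L * √v ≤ splitGap π x) ≤ Real.exp (-v) := by
  have hm' : (0 : ℝ) < m := by exact_mod_cast hm
  have hu' : (0 : ℝ) < u := by exact_mod_cast hu
  have hs := splitScale_pos hm hu
  set s := splitScale m u with hs_def
  -- the exponent that optimizes the Chernoff bound, up to a constant
  set l := √v / (s * L) with hl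
  have hl0 : 0 ≤ l := by positivity
  let c : Fin (m + u) → ℝ := Fin.addCases (fun _ => 1 / (m : ℝ)) (fun _ => -(1 / (u : ℝ)))
  have hc : ∀ k, |c k| ≤ 1 / (m : ℝ) + 1 / u := by
    intro k
    refine Fin.addCases (fun i => ?_) (fun i => ?_) k
    · simp only [c, Fin.addCases_left]; rw [abs_of_pos (by positivity)]
      have : 0 < 1 / (u : ℝ) := by positivity
      linarith
    · simp only [c, Fin.addCases_right]; rw [abs_neg, abs_of_pos (by positivity)]
      have : 0 < 1 / (m : ℝ) := by positivity
      linarith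
  have hc0 : ∑ k, c k = 0 := by
    rw [Fin.sum_univ_add]
    simp only [c, Fin.addCases_left, Fin.addCases_right, sum_const, card_univ, Fintype.card_fin,
      nsmul_eq_mul]
    field_simp
    ring
  have hlin : ∀ π : Equiv.Perm (Fin (m + u)), ∑ k, c k * (l * x (π k)) = l * splitGap π x := by
    intro π
    rw [Fin.sum_univ_add]
    simp only [c, Fin.addCases_left, Fin.addCases_right, splitGap, smul_eq_mul, mul_sub, mul_sum]
    rw [sub_eq_add_neg, ← sum_neg_distrib]
    congr 1 <;> exact sum_congr rfl fun i _ => by ring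
  have h1 := expect_perm_exp_le (m + u) c (fun i => l * x i) (1 / (m : ℝ) + 1 / u) (l * L) hc
    (fun i => by rw [abs_mul, abs_of_nonneg hl0]; exact mul_le_mul_of_nonneg_left (hx i) hl0)
  simp_rw [hlin] at h1
  have h2 : (∑ k, c k) * (∑ k, l * x k) / ((m + u : ℕ) : ℝ) +
      ((m + u : ℕ) : ℝ) * ((4 * (1 / (m : ℝ) + 1 / u) * (l * L)) ^ 2 / 2) = 8 * v := by
    have h3 := splitScale_sq hm hu
    rw [← hs_def] at h3
    have h4 : (l * L) ^ 2 * s ^ 2 = v := by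
      rw [hl, ← mul_pow]
      have : √v / (s * L) * L * s = √v := by field_simp
      rw [this, Real.sq_sqrt hv]
    rw [hc0, zero_mul, zero_div, zero_add]
    calc _ = 8 * ((l * L) ^ 2 * (((m + u : ℕ) : ℝ) * (1 / (m : ℝ) + 1 / u) ^ 2)) := by ring
      _ = _ := by rw [← h3, h4]
  rw [h2] at h1
  have h5 := pr_le_of_expect_exp_le _ (9 * v) _ h1
  rw [show 8 * v - 9 * v = -v by ring] at h5
  refine le_trans (pr_mono fun π hπ => ?_) h5
  have h6 : l * (9 * s * L * √v) = 9 * v := by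
    rw [hl]
    have : √v / (s * L) * (9 * s * L * √v) = 9 * (√v * √v) := by field_simp
    rw [this, Real.mul_self_sqrt hv]
  rw [← h6]
  exact mul_le_mul_of_nonneg_left hπ hl0

theorem norm_le_card_mul {ι : Type*} [Fintype ι] (x : EuclideanSpace ℝ ι) (y : ℝ)
    (h : ∀ κ, |x κ| ≤ y) : ‖x‖ ≤ Fintype.card ι * y := by
  have h1 : ‖x‖ ≤ ∑ κ, |x κ| := by
    rw [EuclideanSpace.norm_eq]
    refine Real.sqrt_le_iff.2 ⟨sum_nonneg fun κ _ => abs_nonneg _, ?_⟩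
    exact sum_sq_le_sq_sum_of_nonneg fun κ _ => abs_nonneg (x κ)
  exact h1.trans ((sum_le_sum fun κ _ => h κ).trans (by simp))

theorem pr_norm_splitGap_gt {m u : ℕ} (hm : 1 ≤ m) (hu : 1 ≤ u) {ι : Type*} [Fintype ι]
    (X : Fin (m + u) → EuclideanSpace ℝ ι) {L v : ℝ} (hL : 0 < L) (hv : 0 ≤ v)
    (hX : ∀ i, ‖X i‖ ≤ L) :
    pr (fun π => Fintype.card ι * (9 * splitScale m u * L * √v) < ‖splitGap π X‖) ≤
      2 * Fintype.card ι * Real.exp (-v) := by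
  set y := 9 * splitScale m u * L * √v
  have hco : ∀ (π : Equiv.Perm (Fin (m + u))) (κ : ι),
      (splitGap π X) κ = splitGap π (fun i => X i κ) := by
    intro π κ
    simp [splitGap]
  have habs : ∀ κ i, |X i κ| ≤ L := fun κ i => by
    have := PiLp.norm_apply_le (X i) κ
    rw [Real.norm_eq_abs] at this
    exact this.trans (hX i)
  have h1 : pr (fun π => Fintype.card ι * y < ‖splitGap π X‖) ≤
      pr (fun π => ∃ κ ∈ (univ : Finset ι),
        (y ≤ splitGap π (fun i => X i κ) ∨ y ≤ splitGap π (fun i => -X i κ))) := by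
    refine pr_mono fun π hπ => ?_
    by_contra hcon
    push Not at hcon
    refine absurd (norm_le_card_mul (splitGap π X) y fun κ => ?_) (not_le.2 hπ)
    obtain ⟨h2, h3⟩ := hcon κ (mem_univ κ)
    have h4 : splitGap π (fun i => -X i κ) = -splitGap π (fun i => X i κ) := by
      simp only [splitGap, sum_neg_distrib, smul_neg]; abel
    rw [hco]
    exact abs_le.2 ⟨by linarith, h2.le⟩
  refine h1.trans ((pr_exists_le _ _).trans ?_)
  calc _ ≤ ∑ κ : ι, (Real.exp (-v) + Real.exp (-v)) := by
        refine sum_le_sum fun κ _ => (pr_or_le _ _).trans (add_le_add ?_ ?_)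
        · exact pr_splitGap_ge hm hu _ hL hv (habs κ)
        · exact pr_splitGap_ge hm hu _ hL hv fun i => by rw [abs_neg]; exact habs κ i
    _ = _ := by simp; ring

/-- The deviation levels are chosen so that a union bound over the links of level `k` and over
the `2 d` signed coordinates costs at most a share `2 ^ (-(k + 2))` of `δ / 2`. -/
theorem exp_neg_level {δ : ℝ} (hδ : 0 < δ) (hδ1 : δ < 1) (d k : ℕ) :
    2 * (d : ℝ) * Real.exp (-((4 * d + 4) * (k + 1) * Real.log (2 / δ))) *
      (((5 ^ d) ^ (k + 1) : ℕ) : ℝ) ≤ δ / 2 * (1 / 2) ^ (k + 2) := by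
  have h1 : Real.exp (-((4 * d + 4) * (k + 1) * Real.log (2 / δ))) =
      (δ / 2) ^ ((4 * d + 4) * (k + 1)) := by
    rw [show -((4 * (d : ℝ) + 4) * (k + 1) * Real.log (2 / δ)) =
      (((4 * d + 4) * (k + 1) : ℕ) : ℝ) * Real.log (δ / 2) by
        rw [← inv_div δ 2, Real.log_inv]; push_cast; ring, Real.exp_nat_mul,
      Real.exp_log (by positivity)]
  obtain ⟨a, ha⟩ : ∃ a, (4 * d + 4) * (k + 1) = a + 1 + (4 * d + 1) * (k + 1) + (k + 2) := by
    refine ⟨2 * k, ?_⟩; ring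
  have h2 : (δ / 2) ^ ((4 * d + 4) * (k + 1)) ≤
      δ / 2 * (1 / 2) ^ ((4 * d + 1) * (k + 1)) * (1 / 2) ^ (k + 2) := by
    rw [ha, show a + 1 + (4 * d + 1) * (k + 1) + (k + 2) =
      a + (1 + (4 * d + 1) * (k + 1) + (k + 2)) by ring, pow_add, pow_add, pow_add, pow_one]
    have h3 : δ / 2 ≤ 1 / 2 := by linarith
    have h4 : (δ / 2) ^ a ≤ 1 := pow_le_one₀ (by positivity) (by linarith)
    calc (δ / 2) ^ a * (δ / 2 * (δ / 2) ^ ((4 * d + 1) * (k + 1)) * (δ / 2) ^ (k + 2))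
        ≤ 1 * (δ / 2 * (1 / 2) ^ ((4 * d + 1) * (k + 1)) * (1 / 2) ^ (k + 2)) := by gcongr
      _ = _ := one_mul _
  have h5 : 2 * d * (5 ^ d) ^ (k + 1) ≤ 2 ^ ((4 * d + 1) * (k + 1)) := by
    have h6 : 5 ^ d ≤ 2 ^ (3 * d) := by rw [pow_mul]; exact Nat.pow_le_pow_left (by norm_num) d
    have h7 : 2 * d ≤ 2 ^ (d + 1) := by
      rw [pow_succ, mul_comm]; exact Nat.mul_le_mul_right _ (Nat.lt_two_pow_self).le
    calc 2 * d * (5 ^ d) ^ (k + 1) ≤ 2 ^ (d + 1) * (2 ^ (3 * d)) ^ (k + 1) := by gcongr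
      _ = 2 ^ (d + 1 + 3 * d * (k + 1)) := by rw [← pow_mul, ← pow_add]
      _ ≤ _ := Nat.pow_le_pow_right (by norm_num) (by nlinarith)
  have h5' : 2 * (d : ℝ) * (((5 ^ d) ^ (k + 1) : ℕ) : ℝ) ≤ 2 ^ ((4 * d + 1) * (k + 1)) := by
    exact_mod_cast h5
  rw [h1]
  calc _ = (2 * (d : ℝ) * (((5 ^ d) ^ (k + 1) : ℕ) : ℝ)) * (δ / 2) ^ ((4 * d + 4) * (k + 1)) := by
        ring
    _ ≤ 2 ^ ((4 * d + 1) * (k + 1)) *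
        (δ / 2 * (1 / 2) ^ ((4 * d + 1) * (k + 1)) * (1 / 2) ^ (k + 2)) := by gcongr
    _ = (2 * (1 / 2)) ^ ((4 * d + 1) * (k + 1)) * (δ / 2 * (1 / 2) ^ (k + 2)) := by
        rw [mul_pow]; ring
    _ = _ := by norm_num

/-- The entropy sum of the chaining argument: at level `k` the increments are at most a multiple of
`2 ^ (-k α)`, and the deviation factor grows like `√(k + 1) ≤ k + 1`. -/
noncomputable def chainSum (α : ℝ) : ℝ := ∑' k : ℕ, ((k : ℝ) + 1) * ((1 / 2 : ℝ) ^ α) ^ k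

theorem sum_le_chainSum {α : ℝ} (hα : 0 < α) (K : ℕ) :
    ∑ k ∈ range K, ((k : ℝ) + 1) * ((1 / 2 : ℝ) ^ α) ^ k ≤ chainSum α := by
  have h0 : 0 < (1 / 2 : ℝ) ^ α := by positivity
  have h1 : (1 / 2 : ℝ) ^ α < 1 := Real.rpow_lt_one (by norm_num) (by norm_num) hα
  refine Summable.sum_le_tsum _ (fun k _ => by positivity) ?_
  simp_rw [add_mul, one_mul]
  have := summable_pow_mul_geometric_of_norm_lt_one 1 (r := (1 / 2 : ℝ) ^ α)
    (by rwa [Real.norm_of_nonneg h0.le])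
  simp only [pow_one] at this
  exact this.add (summable_geometric_of_lt_one h0.le h1)

/-- The Hölder modulus at a distance of at most `R / 2 ^ k`, for `R ≥ 1`. -/
theorem max_rpow_le {α R D : ℝ} (hα : 0 < α) (hα1 : α ≤ 1) (hR : 1 ≤ R) (hD : 0 ≤ D) (k : ℕ)
    (h : D ≤ R / 2 ^ k) : max (D ^ α) D ≤ R * ((1 / 2 : ℝ) ^ α) ^ k := by
  have h0 : D ≤ R * (1 / 2) ^ k := by rw [one_div, inv_pow]; exact h
  have h1 : ((1 / 2 : ℝ) ^ α) ^ k = ((1 / 2 : ℝ) ^ k) ^ α := by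
    rw [← Real.rpow_natCast, ← Real.rpow_natCast, ← Real.rpow_mul (by norm_num),
      ← Real.rpow_mul (by norm_num), mul_comm]
  have h2 : R ^ α ≤ R := by
    simpa using Real.rpow_le_rpow_of_exponent_le hR hα1
  refine max_le ?_ ?_
  · calc D ^ α ≤ (R * (1 / 2) ^ k) ^ α := Real.rpow_le_rpow hD h0 hα.le
      _ = R ^ α * ((1 / 2 : ℝ) ^ k) ^ α := Real.mul_rpow (by linarith) (by positivity)
      _ ≤ _ := by rw [h1]; gcongr
  · refine h0.trans (mul_le_mul_of_nonneg_left ?_ (by linarith))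
    refine pow_le_pow_left₀ (by norm_num) ?_ k
    simpa using Real.rpow_le_rpow_of_exponent_ge (by norm_num : (0 : ℝ) < 1 / 2) (by norm_num) hα1

/-- The dimensional constant of the uniform bound: the weighted entropy sum of all levels, plus one for
the remainder beyond the last level. -/
noncomputable def chainConst (d : ℕ) (α : ℝ) : ℝ := 9 * d * √(4 * d + 4) * (1 + chainSum α) + 1

theorem chainSum_nonneg (α : ℝ) : 0 ≤ chainSum α := tsum_nonneg fun k => by positivity

theorem chainConst_nonneg (d : ℕ) (α : ℝ) : 0 ≤ chainConst d α := by
  have := chainSum_nonneg α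
  unfold chainConst
  positivity

/-- Uniform concentration by chaining: with probability at least `1 - δ / 2` the gap of the
field `g` is small on the whole ball. Only finitely many levels are needed, since on the last one the
Hölder bound for `g` already controls what is left. -/
theorem pr_exists_splitGap_gt {m u : ℕ} (hm : 1 ≤ m) (hu : 1 ≤ u) {ι : Type*} [Fintype ι]
    (g : Fin (m + u) → EuclideanSpace ℝ ι → EuclideanSpace ℝ ι) (c : EuclideanSpace ℝ ι)
    {ρ R B α : ℝ} (hρ : 0 < ρ) (hρR : ρ ≤ R) (hR : 1 ≤ R) (hB : 0 < B) (hα : 0 < α) (hα1 : α ≤ 1)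
    (hgc : ∀ i, ‖g i c‖ ≤ B)
    (hg : ∀ i, ∀ w w', ‖w - c‖ ≤ ρ → ‖w' - c‖ ≤ ρ →
      ‖g i w - g i w'‖ ≤ B * max (‖w - w'‖ ^ α) ‖w - w'‖)
    {δ : ℝ} (hδ : 0 < δ) (hδ1 : δ < 1) :
    pr (fun π : Equiv.Perm (Fin (m + u)) => ∃ w, ‖w - c‖ ≤ ρ ∧
      chainConst (Fintype.card ι) α * splitScale m u * B * R * √(Real.log (2 / δ)) <
        ‖splitGap π (fun i => g i w)‖) ≤ δ / 2 := by
  classical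
  set d := Fintype.card ι with hd
  set s := splitScale m u
  have hs : 0 < s := splitScale_pos hm hu
  set Λ := Real.log (2 / δ) with hΛ
  have hΛ0 : 0 < Λ := Real.log_pos (by rw [lt_div_iff₀ hδ]; linarith)
  set q := (1 / 2 : ℝ) ^ α with hq
  have hq0 : 0 < q := by positivity
  have hq1 : q < 1 := Real.rpow_lt_one (by norm_num) (by norm_num) hα
  obtain ⟨N, hNcard, hNmem, hNchain⟩ := exists_dyadic_nets c hρ
  have hfr : Module.finrank ℝ (EuclideanSpace ℝ ι) = d := finrank_euclideanSpace
  rw [hfr] at hNcard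
  -- beyond level `K` the Hölder bound alone is below the target
  obtain ⟨K, hK⟩ := exists_pow_lt_of_lt_one (show 0 < s * √Λ / 2 by positivity) hq1
  let v : ℕ → ℝ := fun k => (4 * d + 4) * (k + 1) * Λ
  have hv : ∀ k, 0 ≤ v k := fun k => by positivity
  have hsv : ∀ k, √(v k) ≤ √(4 * d + 4) * (k + 1) * √Λ := by
    intro k
    have h1 : √((k : ℝ) + 1) ≤ k + 1 := by
      rw [Real.sqrt_le_left (by positivity)]
      nlinarith [(Nat.cast_nonneg k : (0 : ℝ) ≤ k)]
    simp only [v]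
    rw [Real.sqrt_mul (by positivity), Real.sqrt_mul (by positivity)]
    gcongr
  -- the exceptional events: the centre, and the links of the chains up to level `K`
  let bad0 : Equiv.Perm (Fin (m + u)) → Prop := fun π =>
    d * (9 * s * B * √(v 0)) < ‖splitGap π (fun i => g i c)‖
  let bad : ℕ → EuclideanSpace ℝ ι × EuclideanSpace ℝ ι → Equiv.Perm (Fin (m + u)) → Prop :=
    fun k q' π => d * (9 * s * (B * (R * q ^ k)) * √(v k)) <
      ‖splitGap π (fun i => g i q'.1 - g i q'.2)‖
  have hlink : ∀ i w w' (k : ℕ), ‖w - c‖ ≤ ρ → ‖w' - c‖ ≤ ρ → ‖w - w'‖ ≤ ρ / 2 ^ k →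
      ‖g i w - g i w'‖ ≤ B * (R * q ^ k) := fun i w w' k hw hw' h =>
    (hg i w w' hw hw').trans (mul_le_mul_of_nonneg_left
      (max_rpow_le hα hα1 hR (norm_nonneg _) k (h.trans (by gcongr))) hB.le)
  have hpr : pr (fun π => bad0 π ∨ ∃ k ∈ range K, ∃ q' ∈ N k, bad k q' π) ≤ δ / 2 := by
    have h0 : pr bad0 ≤ δ / 2 * (1 / 2) ^ 2 := by
      refine (pr_norm_splitGap_gt hm hu _ hB (hv 0) hgc).trans ?_
      refine le_trans ?_ (exp_neg_level hδ hδ1 d 0)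
      have h1 : (1 : ℝ) ≤ (((5 ^ d) ^ (0 + 1) : ℕ) : ℝ) := by
        exact_mod_cast Nat.one_le_iff_ne_zero.2 (by positivity)
      have h2 : 0 ≤ 2 * (d : ℝ) * Real.exp (-v 0) := by positivity
      have := mul_le_mul_of_nonneg_left h1 h2
      simpa [v] using this
    have h1 : ∀ k, pr (fun π => ∃ q' ∈ N k, bad k q' π) ≤ δ / 2 * (1 / 2) ^ (k + 2) := by
      intro k
      refine (pr_exists_le _ _).trans ((sum_le_card_nsmul _ _ _ fun q' hq' =>
        pr_norm_splitGap_gt hm hu _ (by positivity) (hv k) fun i =>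
          hlink i _ _ k (hNmem k q' hq').1 (hNmem k q' hq').2.1 (hNmem k q' hq').2.2).trans ?_)
      refine le_trans ?_ (exp_neg_level hδ hδ1 d k)
      rw [nsmul_eq_mul, mul_comm]
      refine mul_le_mul_of_nonneg_left ?_ (by positivity)
      exact_mod_cast hNcard k
    have h2 : ∑ k ∈ range K, δ / 2 * (1 / 2 : ℝ) ^ (k + 2) ≤ δ / 2 * (1 / 2) := by
      rw [← mul_sum]
      refine mul_le_mul_of_nonneg_left ?_ (by positivity)
      have h3 := Summable.sum_le_tsum (range K) (fun k _ => by positivity)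
        (summable_geometric_two : Summable fun k : ℕ => (1 / 2 : ℝ) ^ k)
      rw [tsum_geometric_two] at h3
      simp_rw [pow_add]
      rw [← sum_mul]
      nlinarith
    calc _ ≤ δ / 2 * (1 / 2) ^ 2 + ∑ k ∈ range K, δ / 2 * (1 / 2 : ℝ) ^ (k + 2) :=
          (pr_or_le _ _).trans (add_le_add h0
            ((pr_exists_le _ _).trans (sum_le_sum fun k _ => h1 k)))
      _ ≤ _ := by nlinarith
  refine le_trans (pr_mono fun π hπ => ?_) hpr
  by_contra hcon
  push Not at hcon
  obtain ⟨hc0, hck⟩ := hcon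
  obtain ⟨w, hw, hgt⟩ := hπ
  obtain ⟨p, hp0, hpN, hpc, hpw⟩ := hNchain w hw
  refine absurd hgt (not_lt.2 ?_)
  have tel : splitGap π (fun i => g i w) = splitGap π (fun i => g i c) +
      ∑ k ∈ range K, splitGap π (fun i => g i (p (k + 1)) - g i (p k)) +
      splitGap π (fun i => g i w - g i (p K)) := by
    have h1 : ∀ a b : EuclideanSpace ℝ ι, splitGap π (fun i => g i a - g i b) =
        splitGap π (fun i => g i a) - splitGap π (fun i => g i b) :=
      fun a b => splitGap_sub π (fun i => g i a) (fun i => g i b)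
    simp_rw [h1]
    rw [sum_range_sub (fun k => splitGap π fun i => g i (p k)), hp0]
    abel
  have e0 : ‖splitGap π (fun i => g i c)‖ ≤ 9 * d * √(4 * d + 4) * (s * B * R * √Λ) := by
    refine (not_lt.1 hc0).trans ?_
    have h1 := hsv 0
    simp only [Nat.cast_zero, zero_add, mul_one] at h1
    calc d * (9 * s * B * √(v 0)) ≤ d * (9 * s * B * (√(4 * d + 4) * √Λ)) := by gcongr
      _ = 9 * d * √(4 * d + 4) * (s * B * 1 * √Λ) := by ring
      _ ≤ _ := by gcongr
  have ek : ‖∑ k ∈ range K, splitGap π (fun i => g i (p (k + 1)) - g i (p k))‖ ≤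
      9 * d * √(4 * d + 4) * chainSum α * (s * B * R * √Λ) := by
    calc _ ≤ ∑ k ∈ range K, 9 * d * √(4 * d + 4) * (s * B * R * √Λ) * ((k + 1) * q ^ k) := by
          refine (norm_sum_le _ _).trans (sum_le_sum fun k hk => ?_)
          refine (not_lt.1 (hck k hk _ (hpN k))).trans ?_
          calc d * (9 * s * (B * (R * q ^ k)) * √(v k))
              ≤ d * (9 * s * (B * (R * q ^ k)) * (√(4 * d + 4) * (k + 1) * √Λ)) := by
                gcongr; exact hsv k
            _ = _ := by ring
      _ = 9 * d * √(4 * d + 4) * (s * B * R * √Λ) * ∑ k ∈ range K, ((k : ℝ) + 1) * q ^ k := by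
          rw [mul_sum]
      _ ≤ 9 * d * √(4 * d + 4) * (s * B * R * √Λ) * chainSum α := by
          gcongr; exact sum_le_chainSum hα K
      _ = _ := by ring
  have eK : ‖splitGap π (fun i => g i w - g i (p K))‖ ≤ s * B * R * √Λ := by
    refine (splitGap_norm_le hm hu π _ _ fun i => hlink i w (p K) K hw (hpc K) (hpw K)).trans ?_
    calc 2 * (B * (R * q ^ K)) ≤ 2 * (B * (R * (s * √Λ / 2))) := by gcongr
      _ = _ := by ring
  rw [tel]
  refine (norm_add₃_le).trans ((add_le_add (add_le_add e0 ek) eK).trans (le_of_eq ?_))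
  unfold chainConst
  ring

/-! ### One step of stochastic gradient descent -/

/-- Descent inequality for a function with Hölder continuous gradient. -/
theorem descent_le {E : Type*} [NormedAddCommGroup E] [InnerProductSpace ℝ E] [CompleteSpace E]
    {f : E → ℝ} (hf : Differentiable ℝ f) {s : Set E} (hs : Convex ℝ s) {P α : ℝ} (hP : 0 ≤ P)
    (hα : 0 < α)
    (hg : ∀ w ∈ s, ∀ w' ∈ s, ‖gradient f w - gradient f w'‖ ≤ P * max (‖w - w'‖ ^ α) ‖w - w'‖)
    {w v : E} (hw : w ∈ s) (hwv : w - v ∈ s) :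
    f (w - v) - f w ≤ -inner ℝ (gradient f w) v + P * (max (‖v‖ ^ α) ‖v‖ * ‖v‖) := by
  have hseg : segment ℝ w (w - v) ⊆ s := hs.segment_subset hw hwv
  have h1 := (convex_segment (𝕜 := ℝ) w (w - v)).norm_image_sub_le_of_norm_hasFDerivWithin_le'
    (f := f) (f' := fun z => fderiv ℝ f z) (φ := fderiv ℝ f w)
    (C := P * max (‖v‖ ^ α) ‖v‖) (x := w) (y := w - v)
    (fun z _ => (hf z).hasFDerivAt.hasFDerivWithinAt) (fun z hz => ?_)
    (left_mem_segment ℝ _ _) (right_mem_segment ℝ _ _)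
  · have h2 : fderiv ℝ f w (w - v - w) = -inner ℝ (gradient f w) v := by
      rw [inner_gradient_left, ← map_neg]; congr 1; abel
    have h3 : ‖w - v - w‖ = ‖v‖ := by rw [show w - v - w = -v by abel, norm_neg]
    rw [h2, h3, Real.norm_eq_abs] at h1
    have := (le_abs_self _).trans h1
    linarith
  · have h2 : ‖fderiv ℝ f z - fderiv ℝ f w‖ = ‖gradient f z - gradient f w‖ := by
      rw [← toDual_gradient, ← toDual_gradient, ← map_sub, LinearIsometryEquiv.norm_map]
    have h3 : ‖z - w‖ ≤ ‖v‖ := by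
      have := norm_sub_le_of_mem_segment hz
      rwa [show w - v - w = -v by abel, norm_neg] at this
    rw [h2]
    refine (hg z (hseg hz) w hw).trans (mul_le_mul_of_nonneg_left ?_ hP)
    exact max_le_max (Real.rpow_le_rpow (norm_nonneg _) h3 hα.le) h3

section Step

variable {ι E : Type*} [Fintype ι] [Nonempty ι] [NormedAddCommGroup E] [InnerProductSpace ℝ E]

/-- Three bounds for the remainder of the descent inequality along a step `η • g` with
`√η ‖g‖ ≤ G`, to be averaged under the mean norm condition, averaged under the variance condition, and
used pointwise. -/
theorem remainder_le {η G α : ℝ} (hη : 0 < η) (hη1 : η ≤ 1) (hG : 1 ≤ G) (hα : 0 < α)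
    (hα1 : α ≤ 1) {g : E} (hg : √η * ‖g‖ ≤ G) :
    max (‖η • g‖ ^ α) ‖η • g‖ * ‖η • g‖ ≤ G * (η ^ (1 + α / 2) * ‖g‖) ∧
    max (‖η • g‖ ^ α) ‖η • g‖ * ‖η • g‖ ≤ G * (η ^ (1 + α) * (1 + ‖g‖ ^ 2)) ∧
    max (‖η • g‖ ^ α) ‖η • g‖ * ‖η • g‖ ≤ G ^ 2 := by
  have hv : ‖η • g‖ = η * ‖g‖ := by rw [norm_smul, Real.norm_of_nonneg hη.le]
  have hsq : √η * √η = η := Real.mul_self_sqrt hη.le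
  have hvG : η * ‖g‖ ≤ √η * G := by
    calc η * ‖g‖ = √η * (√η * ‖g‖) := by rw [← mul_assoc, hsq]
      _ ≤ _ := by gcongr
  have hs1 : √η ≤ 1 := Real.sqrt_le_one.2 hη1
  have hvG1 : η * ‖g‖ ≤ G := hvG.trans (by nlinarith)
  have hsα : √η ≤ η ^ (α / 2) := by
    rw [Real.sqrt_eq_rpow]
    exact Real.rpow_le_rpow_of_exponent_ge hη hη1 (by linarith)
  have hGα : G ^ α ≤ G := by simpa using Real.rpow_le_rpow_of_exponent_le hG hα1
  have hmax1 : max ((η * ‖g‖) ^ α) (η * ‖g‖) ≤ η ^ (α / 2) * G := by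
    refine max_le ?_ (hvG.trans (by gcongr))
    calc (η * ‖g‖) ^ α ≤ (√η * G) ^ α := by gcongr
      _ = √η ^ α * G ^ α := Real.mul_rpow (by positivity) (by positivity)
      _ ≤ _ := by
        rw [Real.sqrt_eq_rpow, ← Real.rpow_mul hη.le, one_div_mul_eq_div]; gcongr
  have hmax2 : max ((η * ‖g‖) ^ α) (η * ‖g‖) ≤ G := by
    refine hmax1.trans ?_
    have : η ^ (α / 2) ≤ 1 := Real.rpow_le_one hη.le hη1 (by linarith)
    nlinarith
  have hmax3 : max ((η * ‖g‖) ^ α) (η * ‖g‖) ≤ G * (η * ‖g‖) ^ α := by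
    have h0 : 0 ≤ (η * ‖g‖) ^ α := by positivity
    refine max_le (by nlinarith) ?_
    rcases (norm_nonneg g).eq_or_lt with h | h
    · rw [← h]; simp [Real.zero_rpow hα.ne']
    have hpos : 0 < η * ‖g‖ := by positivity
    calc η * ‖g‖ = (η * ‖g‖) ^ (1 - α) * (η * ‖g‖) ^ α := by
          rw [← Real.rpow_add hpos]; simp
      _ ≤ G * (η * ‖g‖) ^ α := by
          gcongr
          calc (η * ‖g‖) ^ (1 - α) ≤ G ^ (1 - α) :=
                Real.rpow_le_rpow hpos.le hvG1 (by linarith)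
            _ ≤ G ^ (1 : ℝ) := Real.rpow_le_rpow_of_exponent_le hG (by linarith)
            _ = G := Real.rpow_one G
  rw [hv]
  refine ⟨?_, ?_, ?_⟩
  · calc _ ≤ η ^ (α / 2) * G * (η * ‖g‖) := by gcongr
      _ = _ := by rw [Real.rpow_add hη, Real.rpow_one]; ring
  · have h1 : ‖g‖ ^ α * ‖g‖ ≤ 1 + ‖g‖ ^ 2 := by
      rcases le_total ‖g‖ 1 with h | h
      · have : ‖g‖ ^ α ≤ 1 := Real.rpow_le_one (norm_nonneg _) h hα.le
        nlinarith [norm_nonneg g]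
      · have : ‖g‖ ^ α ≤ ‖g‖ := by simpa using Real.rpow_le_rpow_of_exponent_le h hα1
        nlinarith [norm_nonneg g]
    calc _ ≤ G * (η * ‖g‖) ^ α * (η * ‖g‖) := by gcongr
      _ = G * (η ^ (1 + α) * (‖g‖ ^ α * ‖g‖)) := by
        rw [Real.mul_rpow hη.le (norm_nonneg _), Real.rpow_add hη, Real.rpow_one]; ring
      _ ≤ _ := by gcongr
  · calc _ ≤ G * G := by gcongr
      _ = _ := by ring

theorem expect_remainder_le {η G α σ₀ : ℝ} (hη : 0 < η) (hη1 : η ≤ 1) (hG : 1 ≤ G) (hα : 0 < α)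
    (hα1 : α ≤ 1) (g : ι → E) (gm : E) (hg : ∀ i, √η * ‖g i‖ ≤ G)
    (hnoise : 𝔼 i, ‖g i‖ ≤ σ₀ ^ 2 ∨ 𝔼 i, ‖g i - gm‖ ^ 2 ≤ σ₀ ^ 2) :
    𝔼 i, max (‖η • g i‖ ^ α) ‖η • g i‖ * ‖η • g i‖ ≤
      2 * G * ((1 + σ₀ ^ 2) * η ^ (1 + α / 2) + η ^ (1 + α) * ‖gm‖ ^ 2) := by
  have hp1 : 0 < η ^ (1 + α / 2) := by positivity
  have hp2 : 0 < η ^ (1 + α) := by positivity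
  have hp : η ^ (1 + α) ≤ η ^ (1 + α / 2) :=
    Real.rpow_le_rpow_of_exponent_ge hη hη1 (by linarith)
  rcases hnoise with h | h
  · calc _ ≤ 𝔼 i, G * (η ^ (1 + α / 2) * ‖g i‖) :=
          expect_le_expect fun i _ => (remainder_le hη hη1 hG hα hα1 (hg i)).1
      _ = G * (η ^ (1 + α / 2) * 𝔼 i, ‖g i‖) := by simp_rw [mul_expect]
      _ ≤ G * (η ^ (1 + α / 2) * σ₀ ^ 2) := by gcongr
      _ ≤ G * (2 * ((1 + σ₀ ^ 2) * η ^ (1 + α / 2) + η ^ (1 + α) * ‖gm‖ ^ 2)) := by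
          refine mul_le_mul_of_nonneg_left ?_ (by linarith)
          nlinarith [sq_nonneg σ₀, mul_nonneg hp2.le (sq_nonneg ‖gm‖), mul_nonneg hp1.le (sq_nonneg σ₀)]
      _ = _ := by ring
  · have h2 : ∀ i, ‖g i‖ ^ 2 ≤ 2 * ‖g i - gm‖ ^ 2 + 2 * ‖gm‖ ^ 2 := fun i => by
      have h3 : ‖g i‖ ≤ ‖g i - gm‖ + ‖gm‖ := by simpa using norm_add_le (g i - gm) gm
      nlinarith [norm_nonneg (g i), sq_nonneg (‖g i - gm‖ - ‖gm‖)]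
    calc _ ≤ 𝔼 i, G * (η ^ (1 + α) * (1 + 2 * ‖gm‖ ^ 2 + 2 * ‖g i - gm‖ ^ 2)) := by
          refine expect_le_expect fun i _ => (remainder_le hη hη1 hG hα hα1 (hg i)).2.1.trans ?_
          have := h2 i
          gcongr G * (η ^ (1 + α) * ?_)
          linarith
      _ = G * (η ^ (1 + α) * (1 + 2 * ‖gm‖ ^ 2 + 2 * 𝔼 i, ‖g i - gm‖ ^ 2)) := by
          rw [← mul_expect, ← mul_expect, expect_add_distrib, Fintype.expect_const, ← mul_expect]
      _ ≤ G * (η ^ (1 + α) * (1 + 2 * ‖gm‖ ^ 2 + 2 * σ₀ ^ 2)) := by gcongr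
      _ ≤ G * (2 * ((1 + σ₀ ^ 2) * η ^ (1 + α / 2) + η ^ (1 + α) * ‖gm‖ ^ 2)) := by
          refine mul_le_mul_of_nonneg_left ?_ (by linarith)
          nlinarith [mul_nonneg (sub_nonneg.2 hp) (sq_nonneg σ₀)]
      _ = _ := by ring

/-- The parameter of the exponential moment of the energy, small enough that the exponents of single
steps are at most `1` in absolute value. -/
noncomputable def energyRate (G P : ℝ) : ℝ := 1 / (8 * G ^ 2 * (1 + P))

/-- The factor of `η ^ (1 + α / 2)` in the per-step energy bound. -/
noncomputable def energyNoise (α P G σ₀ : ℝ) : ℝ :=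
  4 * P * G * (1 + σ₀ ^ 2) + 4 * P * G * G ^ 2 * (16 * P * G) ^ (1 / α)

/-- The part of the remainder proportional to `η ^ (1 + α) x`, where `x` is a squared gradient norm.
For small `η` a quarter of `η x` absorbs it. Otherwise `η` is bounded below by a constant, and
`η x ≤ G²` makes it a multiple of `η ^ (1 + α / 2)`. -/
theorem absorb_le {η G P α x : ℝ} (hη : 0 < η) (hη1 : η ≤ 1) (hG : 1 ≤ G) (hα : 0 < α)
    (hP : 0 ≤ P) (hx : 0 ≤ x) (hxG : η * x ≤ G ^ 2) :
    4 * P * G * (η ^ (1 + α) * x) ≤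
      1 / 4 * (η * x) + 4 * P * G * G ^ 2 * (16 * P * G) ^ (1 / α) * η ^ (1 + α / 2) := by
  set M := 4 * P * G with hM
  have hM0 : 0 ≤ M := by positivity
  have h16 : 16 * P * G = 4 * M := by rw [hM]; ring
  have hr : 0 ≤ (16 * P * G) ^ (1 / α) := by positivity
  have h1 : η ^ (1 + α) = η * η ^ α := by rw [Real.rpow_add hη, Real.rpow_one]
  have hp : 0 < η ^ (1 + α / 2) := by positivity
  rcases le_or_gt (M * η ^ α) (1 / 4) with h | h
  · have h2 : M * (η ^ (1 + α) * x) = M * η ^ α * (η * x) := by rw [h1]; ring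
    rw [h2]
    have h3 : 0 ≤ η * x := by positivity
    have h4 : 0 ≤ M * G ^ 2 * (16 * P * G) ^ (1 / α) * η ^ (1 + α / 2) := by positivity
    nlinarith
  · have h2 : 1 ≤ (16 * P * G) ^ (1 / α) * η := by
      rw [h16]
      have h3 : (1 : ℝ) ≤ (4 * M * η ^ α) ^ (1 / α) :=
        Real.one_le_rpow (by linarith) (by positivity)
      rwa [Real.mul_rpow (by positivity) (by positivity), ← Real.rpow_mul hη.le,
        mul_one_div_cancel hα.ne', Real.rpow_one] at h3
    have h5 : η ^ α ≤ η ^ (α / 2) := Real.rpow_le_rpow_of_exponent_ge hη hη1 (by linarith)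
    have h6 : η ^ (1 + α / 2) = η * η ^ (α / 2) := by rw [Real.rpow_add hη, Real.rpow_one]
    have h7 : 0 ≤ 1 / 4 * (η * x) := by positivity
    calc M * (η ^ (1 + α) * x) = M * η ^ α * (η * x) := by rw [h1]; ring
      _ ≤ M * η ^ (α / 2) * G ^ 2 := by gcongr
      _ = M * G ^ 2 * η ^ (α / 2) * 1 := by ring
      _ ≤ M * G ^ 2 * η ^ (α / 2) * ((16 * P * G) ^ (1 / α) * η) := by gcongr
      _ = M * G ^ 2 * (16 * P * G) ^ (1 / α) * η ^ (1 + α / 2) := by rw [h6]; ring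
      _ ≤ _ := by linarith

theorem energy_exponent_le {l G P Q A p r α σ₀ : ℝ} (hl0 : 0 ≤ l)
    (hlG : l * (8 * G ^ 2 * (1 + P)) = 1) (hP : 0 ≤ P) (hG : 1 ≤ G) (hQ0 : 0 ≤ Q) (hA : 0 ≤ A)
    (hQ : Q ≤ 2 * G * ((1 + σ₀ ^ 2) * p + r))
    (habs : 4 * P * G * r ≤ 1 / 4 * A + 4 * P * G * G ^ 2 * (16 * P * G) ^ (1 / α) * p) :
    -A + P * Q + l * (2 * (A * G ^ 2) + 2 * P ^ 2 * (G ^ 2 * Q)) ≤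
      -(1 / 2) * A + energyNoise α P G σ₀ * p := by
  have h1 : l * G ^ 2 * (1 + P) = 1 / 8 := by linarith
  have h2 : l * G ^ 2 ≤ 1 / 8 := by
    have : 0 ≤ l * G ^ 2 * P := by positivity
    linarith
  have h3 : l * G ^ 2 * P ≤ 1 / 8 := by
    have : 0 ≤ l * G ^ 2 := by positivity
    linarith
  have h5 : l * G ^ 2 * A ≤ 1 / 8 * A := by gcongr
  have h9 : 0 ≤ P * Q := by positivity
  have h6 : l * G ^ 2 * P * (P * Q) ≤ 1 / 8 * (P * Q) := by gcongr
  have h7 : P * Q ≤ P * (2 * G * ((1 + σ₀ ^ 2) * p + r)) := by gcongr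
  have h10 : l * (2 * (A * G ^ 2) + 2 * P ^ 2 * (G ^ 2 * Q)) =
    2 * (l * G ^ 2 * A) + 2 * (l * G ^ 2 * P * (P * Q)) := by ring
  have h11 : energyNoise α P G σ₀ * p = 4 * P * G * (1 + σ₀ ^ 2) * p +
    4 * P * G * G ^ 2 * (16 * P * G) ^ (1 / α) * p := by rw [energyNoise]; ring
  have h12 : P * (2 * G * ((1 + σ₀ ^ 2) * p + r)) =
    (4 * P * G * (1 + σ₀ ^ 2) * p + 4 * P * G * r) / 2 := by ring
  rw [h10, h11]
  linarith

/-- The exponential moment of one step of the descent inequality. The exponent is small enough for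
`exp x ≤ 1 + x + x²`, and its quadratic term is dominated by the negative mean drift. -/
theorem expect_exp_energy_step {η G α P σ₀ : ℝ} (hη : 0 < η) (hη1 : η ≤ 1) (hG : 1 ≤ G)
    (hα : 0 < α) (hα1 : α ≤ 1) (hP : 0 ≤ P) (g : ι → E) (gm : E) 
    (hgm : (1 / (Fintype.card ι : ℝ)) • ∑ i, g i = gm)
    (hg : ∀ i, √η * ‖g i‖ ≤ G)
    (hnoise : 𝔼 i, ‖g i‖ ≤ σ₀ ^ 2 ∨ 𝔼 i, ‖g i - gm‖ ^ 2 ≤ σ₀ ^ 2) :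
    𝔼 i, Real.exp (energyRate G P * (-inner ℝ gm (η • g i) +
        P * (max (‖η • g i‖ ^ α) ‖η • g i‖ * ‖η • g i‖))) ≤
      Real.exp (energyRate G P *
        (-(1 / 2) * (η * ‖gm‖ ^ 2) + energyNoise α P G σ₀ * η ^ (1 + α / 2))) := by
  set l := energyRate G P with hl
  have hl0 : 0 < l := by rw [hl, energyRate]; positivity
  have hlG : l * (8 * G ^ 2 * (1 + P)) = 1 := by rw [hl, energyRate]; field_simp
  have hG2 : 1 ≤ G ^ 2 := one_le_pow₀ hG
  set q : ι → ℝ := fun i => max (‖η • g i‖ ^ α) ‖η • g i‖ * ‖η • g i‖ with hq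
  set Q := 𝔼 i, q i with hQ
  have hq0 : ∀ i, 0 ≤ q i := fun i => mul_nonneg (le_max_of_le_right (norm_nonneg _)) (norm_nonneg _)
  have hqG : ∀ i, q i ≤ G ^ 2 := fun i => (remainder_le hη hη1 hG hα hα1 (hg i)).2.2
  have hQ0 : 0 ≤ Q := expect_nonneg fun i _ => hq0 i
  have hsq : √η * √η = η := Real.mul_self_sqrt hη.le
  have hgmG : √η * ‖gm‖ ≤ G := by
    have h1 : ‖gm‖ ≤ 𝔼 i, ‖g i‖ := by
      rw [← hgm, Fintype.expect_eq_sum_div_card, norm_smul, norm_div, norm_one,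
        RCLike.norm_natCast, one_div_mul_eq_div]
      exact div_le_div_of_nonneg_right (norm_sum_le _ _) (by positivity)
    calc √η * ‖gm‖ ≤ √η * 𝔼 i, ‖g i‖ := by gcongr
      _ = 𝔼 i, √η * ‖g i‖ := mul_expect _ _ _
      _ ≤ G := expect_le univ_nonempty fun i _ => hg i
  have hgm2 : η * ‖gm‖ ^ 2 ≤ G ^ 2 := by
    calc η * ‖gm‖ ^ 2 = (√η * ‖gm‖) ^ 2 := by rw [mul_pow, pow_two √η, hsq]
      _ ≤ _ := by gcongr
  have hinner : ∀ i, |inner ℝ gm (η • g i)| ≤ √η * ‖gm‖ * G := fun i => by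
    refine (abs_real_inner_le_norm _ _).trans ?_
    rw [norm_smul, Real.norm_of_nonneg hη.le]
    calc ‖gm‖ * (η * ‖g i‖) = √η * ‖gm‖ * (√η * ‖g i‖) := by
          rw [show √η * ‖gm‖ * (√η * ‖g i‖) = √η * √η * (‖gm‖ * ‖g i‖) by ring, hsq]; ring
      _ ≤ _ := by gcongr; exact hg i
  have hinner1 : ∀ i, |inner ℝ gm (η • g i)| ≤ G ^ 2 := fun i =>
    (hinner i).trans (by nlinarith)
  have hinner2 : ∀ i, (inner ℝ gm (η • g i)) ^ 2 ≤ η * ‖gm‖ ^ 2 * G ^ 2 := fun i => by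
    rw [← sq_abs]
    calc |inner ℝ gm (η • g i)| ^ 2 ≤ (√η * ‖gm‖ * G) ^ 2 := by gcongr; exact hinner i
      _ = _ := by rw [mul_pow, mul_pow, pow_two √η, hsq]
  have hpt : ∀ i, Real.exp (l * (-inner ℝ gm (η • g i) + P * q i)) ≤
      1 + l * (-inner ℝ gm (η • g i) + P * q i) +
        l ^ 2 * (2 * (η * ‖gm‖ ^ 2 * G ^ 2) + 2 * P ^ 2 * (G ^ 2 * q i)) := by
    intro i
    set Y := -inner ℝ gm (η • g i) + P * q i with hY
    have hYabs : |Y| ≤ G ^ 2 * (1 + P) := by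
      refine (abs_add_le _ _).trans ?_
      rw [abs_neg, abs_of_nonneg (mul_nonneg hP (hq0 i))]
      nlinarith [hinner1 i, mul_le_mul_of_nonneg_left (hqG i) hP]
    have hlY : |l * Y| ≤ 1 := by
      rw [abs_mul, abs_of_pos hl0]
      have : 0 ≤ l * (G ^ 2 * (1 + P)) := by positivity
      nlinarith [mul_le_mul_of_nonneg_left hYabs hl0.le]
    have h1 := (le_abs_self _).trans (Real.abs_exp_sub_one_sub_id_le hlY)
    have h2 : Y ^ 2 ≤ 2 * (η * ‖gm‖ ^ 2 * G ^ 2) + 2 * P ^ 2 * (G ^ 2 * q i) := by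
      have h3 : q i ^ 2 ≤ G ^ 2 * q i := by nlinarith [hq0 i, hqG i]
      have h4 : Y ^ 2 ≤ 2 * (inner ℝ gm (η • g i)) ^ 2 + 2 * (P ^ 2 * q i ^ 2) := by
        rw [hY]; nlinarith [sq_nonneg (inner ℝ gm (η • g i) + P * q i)]
      nlinarith [hinner2 i, mul_le_mul_of_nonneg_left h3 (sq_nonneg P)]
    nlinarith [mul_le_mul_of_nonneg_left h2 (sq_nonneg l)]
  have hinn : 𝔼 i, inner ℝ gm (η • g i) = η * ‖gm‖ ^ 2 := by
    simp_rw [inner_smul_right]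
    rw [← mul_expect]
    have h1 : 𝔼 i, inner ℝ gm (g i) = inner ℝ gm gm := by
      conv_rhs => rw [← hgm, inner_smul_right, hgm, inner_sum]
      rw [Fintype.expect_eq_sum_div_card, one_div_mul_eq_div]
    rw [h1, real_inner_self_eq_norm_sq]
  have hQle := expect_remainder_le hη hη1 hG hα hα1 g gm hg hnoise
  rw [← hq] at hQle
  change Q ≤ _ at hQle
  have habs := absorb_le hη hη1 hG hα hP (sq_nonneg ‖gm‖) hgm2
  calc 𝔼 i, Real.exp (l * (-inner ℝ gm (η • g i) + P * q i))
      ≤ 𝔼 i, (1 + l * (-inner ℝ gm (η • g i) + P * q i) +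
        l ^ 2 * (2 * (η * ‖gm‖ ^ 2 * G ^ 2) + 2 * P ^ 2 * (G ^ 2 * q i))) :=
        expect_le_expect fun i _ => hpt i
    _ = 1 + (l * (-(η * ‖gm‖ ^ 2) + P * Q) +
        l ^ 2 * (2 * (η * ‖gm‖ ^ 2 * G ^ 2) + 2 * P ^ 2 * (G ^ 2 * Q))) := by
        simp only [expect_add_distrib, ← mul_expect, expect_neg_distrib, Fintype.expect_const, hinn,
          ← hQ]
        ring
    _ ≤ 1 + l * (-(1 / 2) * (η * ‖gm‖ ^ 2) + energyNoise α P G σ₀ * η ^ (1 + α / 2)) := by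
        have h8 := energy_exponent_le hl0.le hlG hP hG hQ0 (by positivity) hQle habs
        have h9 := mul_le_mul_of_nonneg_left h8 hl0.le
        rw [mul_add] at h9
        refine le_trans (le_of_eq ?_) (add_le_add_right h9 1)
        ring
    _ ≤ _ := by rw [add_comm]; exact Real.add_one_le_exp _

end Step

/-! ### The trajectory of stochastic gradient descent -/

section Trajectory

variable {m u : ℕ} (F : Problem (m + u))

theorem hasGradientAt_avg {F : Problem (m + u)} (hF : ∀ i, Differentiable ℝ (F.loss i)) {k : ℕ}
    (a : Fin k → Fin (m + u)) (w : F.Param) :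
    HasGradientAt (fun w => (1 / (k : ℝ)) * ∑ i, F.loss (a i) w)
      ((1 / (k : ℝ)) • ∑ i, gradient (F.loss (a i)) w) w := by
  rw [hasGradientAt_iff_hasFDerivAt]
  have h : ∀ i, HasFDerivAt (F.loss (a i)) (InnerProductSpace.toDual ℝ F.Param
      (gradient (F.loss (a i)) w)) w := fun i => ((hF (a i)) w).hasGradientAt.hasFDerivAt
  have := (HasFDerivAt.fun_sum (u := univ) fun i _ => h i).const_mul (1 / (k : ℝ))
  simpa using this

theorem gradient_trainRisk {F : Problem (m + u)} (hF : ∀ i, Differentiable ℝ (F.loss i))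
    (π : Equiv.Perm (Fin (m + u))) (w : F.Param) :
    gradient (trainRisk F π) w = (1 / (m : ℝ)) • ∑ i, stochGrad F π w i :=
  (hasGradientAt_avg hF (fun i => π (Fin.castAdd u i)) w).gradient

theorem gradient_testRisk {F : Problem (m + u)} (hF : ∀ i, Differentiable ℝ (F.loss i))
    (π : Equiv.Perm (Fin (m + u))) (w : F.Param) :
    gradient (testRisk F π) w =
      (1 / (u : ℝ)) • ∑ i, gradient (F.loss (π (Fin.natAdd m i))) w :=
  (hasGradientAt_avg hF (fun i => π (Fin.natAdd m i)) w).gradient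

theorem differentiable_trainRisk {F : Problem (m + u)} (hF : ∀ i, Differentiable ℝ (F.loss i))
    (π : Equiv.Perm (Fin (m + u))) : Differentiable ℝ (trainRisk F π) := fun w =>
  (hasGradientAt_avg hF (fun i => π (Fin.castAdd u i)) w).differentiableAt

theorem loss_nonneg (i : Fin (m + u)) (w : F.Param) : 0 ≤ F.loss i w := by
  have h1 : F.predict w i (F.y i) ≤ 1 := by
    unfold Problem.predict
    refine div_le_one_of_le₀ ?_ (sum_nonneg fun _ _ => (Real.exp_pos _).le)
    exact single_le_sum (f := fun l => Real.exp (F.eval w F.net i l))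
      (fun _ _ => (Real.exp_pos _).le) (mem_univ _)
  have h0 : 0 ≤ F.predict w i (F.y i) :=
    div_nonneg (Real.exp_pos _).le (sum_nonneg fun _ _ => (Real.exp_pos _).le)
  exact neg_nonneg.2 (Real.log_nonpos h0 h1)

theorem trainRisk_nonneg (π : Equiv.Perm (Fin (m + u))) (w : F.Param) : 0 ≤ trainRisk F π w :=
  mul_nonneg (by positivity) (sum_nonneg fun _ _ => loss_nonneg F _ w)

theorem trainRisk_le (hm : 1 ≤ m) (π : Equiv.Perm (Fin (m + u))) (w : F.Param) (b : ℝ)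
    (hb : ∀ i, F.loss i w ≤ b) : trainRisk F π w ≤ b := by
  have hm' : (0 : ℝ) < m := by exact_mod_cast hm
  rw [trainRisk, one_div_mul_eq_div, div_le_iff₀ hm']
  exact (sum_le_sum fun i _ => hb _).trans (by simp [mul_comm])

theorem trainRisk_holder {F : Problem (m + u)} (hm : 1 ≤ m) (hF : ∀ i, Differentiable ℝ (F.loss i))
    {α r P : ℝ} {w₁ : F.Param} (hP : F.IsHolderSmooth α w₁ r P) (π : Equiv.Perm (Fin (m + u))) :
    ∀ w ∈ Metric.closedBall w₁ r, ∀ w' ∈ Metric.closedBall w₁ r,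
      ‖gradient (trainRisk F π) w - gradient (trainRisk F π) w'‖ ≤
        P * max (‖w - w'‖ ^ α) ‖w - w'‖ := by
  intro w hw w' hw'
  have hm' : (0 : ℝ) < m := by exact_mod_cast hm
  rw [gradient_trainRisk hF, gradient_trainRisk hF, ← smul_sub, ← sum_sub_distrib, norm_smul,
    Real.norm_of_nonneg (by positivity), one_div, inv_mul_le_iff₀ hm']
  exact (norm_sum_le _ _).trans ((sum_le_sum fun i _ => hP.2 _ w hw w' hw').trans (by simp))

variable (η : ℕ → ℝ) (w₁ : F.Param) (π : Equiv.Perm (Fin (m + u)))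

/-- The accumulated squared gradient norms `∑ η_s ‖∇R_m(w^(s))‖²` along a trajectory. -/
noncomputable def energy : (t : ℕ) → (Fin t → Fin m) → ℝ
  | 0, _ => 0
  | t + 1, j => energy t (Fin.init j) +
      η (t + 1) * ‖gradient (trainRisk F π) (sgd F η w₁ π t (Fin.init j))‖ ^ 2

/-- The accumulated drift `∑ η_s ∇R_m(w^(s))` along a trajectory. -/
noncomputable def drift : (t : ℕ) → (Fin t → Fin m) → F.Param
  | 0, _ => 0
  | t + 1, j => drift t (Fin.init j) +
      η (t + 1) • gradient (trainRisk F π) (sgd F η w₁ π t (Fin.init j))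

/-- Cauchy–Schwarz along a trajectory. -/
theorem norm_drift_sq_le (hη : ∀ t, 0 ≤ η (t + 1)) : ∀ (t : ℕ) (j : Fin t → Fin m),
    0 ≤ energy F η w₁ π t j ∧
    ‖drift F η w₁ π t j‖ ^ 2 ≤ (∑ s ∈ range t, η (s + 1)) * energy F η w₁ π t j
  | 0, j => by simp [drift, energy]
  | t + 1, j => by
    obtain ⟨h0, h1⟩ := norm_drift_sq_le hη t (Fin.init j)
    simp only [drift, energy, sum_range_succ]
    set D := drift F η w₁ π t (Fin.init j)
    set v := gradient (trainRisk F π) (sgd F η w₁ π t (Fin.init j))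
    set E := energy F η w₁ π t (Fin.init j)
    set S := ∑ s ∈ range t, η (s + 1)
    set e := η (t + 1)
    have he : 0 ≤ e := hη t
    have hS : 0 ≤ S := sum_nonneg fun s _ => hη s
    refine ⟨by positivity, ?_⟩
    have h2 : ‖D + e • v‖ ≤ ‖D‖ + e * ‖v‖ := by
      refine (norm_add_le _ _).trans ?_
      rw [norm_smul, Real.norm_of_nonneg he]
    have h3 : 2 * ‖D‖ * ‖v‖ ≤ S * ‖v‖ ^ 2 + E := by
      refine abs_le_of_sq_le_sq' ?_ (by positivity) |>.2
      nlinarith [sq_nonneg (S * ‖v‖ ^ 2 - E), mul_le_mul_of_nonneg_right h1 (sq_nonneg ‖v‖)]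
    calc ‖D + e • v‖ ^ 2 ≤ (‖D‖ + e * ‖v‖) ^ 2 := by gcongr
      _ = ‖D‖ ^ 2 + e * (2 * ‖D‖ * ‖v‖) + e ^ 2 * ‖v‖ ^ 2 := by ring
      _ ≤ S * E + e * (S * ‖v‖ ^ 2 + E) + e ^ 2 * ‖v‖ ^ 2 := by gcongr
      _ = _ := by ring

end Trajectory

/-! ### Step sizes -/

theorem sum_step_le {t₀ : ℝ} (ht₀ : 1 ≤ t₀) {η : ℕ → ℝ} (hη : ∀ t, 1 ≤ t → η t = 1 / ((t : ℝ) + t₀))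
    {T : ℕ} (hT : 2 ≤ T) : ∑ s ∈ range T, η (s + 1) ≤ 2 * Real.log T := by
  have h1 : ∀ T : ℕ, ∑ s ∈ range T, η (s + 1) ≤ Real.log (T + 1) := by
    intro T
    induction T with
    | zero => simp
    | succ T ih =>
      rw [sum_range_succ]
      have h2 : η (T + 1) ≤ 1 / ((T : ℝ) + 2) := by
        rw [hη _ (by omega)]
        push_cast
        exact one_div_le_one_div_of_le (by positivity) (by linarith)
      have h3 := Real.one_sub_inv_le_log_of_pos (x := ((T : ℝ) + 2) / (T + 1)) (by positivity)
      rw [Real.log_div (by positivity) (by positivity)] at h3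
      have h4 : 1 - (((T : ℝ) + 2) / (T + 1))⁻¹ = 1 / ((T : ℝ) + 2) := by field_simp; ring
      push_cast
      rw [show (T : ℝ) + 1 + 1 = T + 2 by ring]
      linarith
  refine (h1 T).trans ?_
  have h2 : (2 : ℝ) ≤ T := by exact_mod_cast hT
  rw [← Real.log_rpow (by linarith)]
  refine Real.log_le_log (by positivity) ?_
  norm_num
  nlinarith

/-- The value of the convergent series that dominates `∑ η_t ^ (1 + α / 2)`. -/
noncomputable def stepSeries (α : ℝ) : ℝ := ∑' k : ℕ, (1 / ((k : ℝ) + 1)) ^ (1 + α / 2)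

theorem sum_step_rpow_le {t₀ α : ℝ} (hα : 0 < α) (ht₀ : 1 ≤ t₀) {η : ℕ → ℝ}
    (hη : ∀ t, 1 ≤ t → η t = 1 / ((t : ℝ) + t₀)) (T : ℕ) :
    ∑ s ∈ range T, η (s + 1) ^ (1 + α / 2) ≤ stepSeries α := by
  have hsum : Summable fun k : ℕ => (1 / ((k : ℝ) + 1)) ^ (1 + α / 2) := by
    have h1 := (summable_nat_add_iff 1).2
      (Real.summable_one_div_nat_rpow.2 (show 1 < 1 + α / 2 by linarith))
    refine h1.congr fun k => ?_
    rw [Real.div_rpow (by norm_num) (by positivity), Real.one_rpow]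
    push_cast
    rfl
  refine le_trans (sum_le_sum fun s _ => ?_) (hsum.sum_le_tsum (range T) fun k _ => by positivity)
  have h1 : η (s + 1) = 1 / ((s : ℝ) + 1 + t₀) := by rw [hη _ (by omega)]; push_cast; rfl
  rw [h1]
  refine Real.rpow_le_rpow (by positivity) ?_ (by linarith)
  exact one_div_le_one_div_of_le (by positivity) (by linarith)

/-! ### Tail bounds for the iterates -/

section Tails

variable {m u : ℕ} {F : Problem (m + u)} {η : ℕ → ℝ} {w₁ : F.Param} {r t₀ α P G σ₀ : ℝ} {T : ℕ}

theorem sgd_snoc (π : Equiv.Perm (Fin (m + u))) (t : ℕ) (j : Fin t → Fin m) (i : Fin m) :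
    sgd F η w₁ π (t + 1) (Fin.snoc j i) =
      sgd F η w₁ π t j - η (t + 1) • stochGrad F π (sgd F η w₁ π t j) i := by
  simp [sgd]

theorem energy_snoc (π : Equiv.Perm (Fin (m + u))) (t : ℕ) (j : Fin t → Fin m) (i : Fin m) :
    energy F η w₁ π (t + 1) (Fin.snoc j i) = energy F η w₁ π t j +
      η (t + 1) * ‖gradient (trainRisk F π) (sgd F η w₁ π t j)‖ ^ 2 := by
  simp [energy]

theorem drift_snoc (π : Equiv.Perm (Fin (m + u))) (t : ℕ) (j : Fin t → Fin m) (i : Fin m) :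
    drift F η w₁ π (t + 1) (Fin.snoc j i) = drift F η w₁ π t j +
      η (t + 1) • gradient (trainRisk F π) (sgd F η w₁ π t j) := by
  simp [drift]

/-- The exponential supermartingale of training risk, energy and accumulated noise. -/
theorem expect_exp_energy_le (hm : 1 ≤ m) (hF : ∀ i, Differentiable ℝ (F.loss i)) (hα : 0 < α)
    (hα1 : α ≤ 1) (hη : ∀ t, 0 < η (t + 1) ∧ η (t + 1) ≤ 1) (hG : 1 ≤ G)
    (hP : F.IsHolderSmooth α w₁ r P) (hin : StaysIn F η w₁ r T)
    (hgrad : BoundedGradients F η w₁ T G) (hnoise : BoundedNoise F η w₁ T σ₀)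
    (π : Equiv.Perm (Fin (m + u))) :
    𝔼 j : Fin T → Fin m, Real.exp (energyRate G P * (trainRisk F π (sgd F η w₁ π T j) +
      energy F η w₁ π T j / 2 - energyNoise α P G σ₀ * ∑ s ∈ range T, η (s + 1) ^ (1 + α / 2))) ≤
      Real.exp (energyRate G P * trainRisk F π w₁) := by
  have : NeZero m := ⟨by omega⟩
  have key := expect_exp_le_of_step (m := m) (fun t j => energyRate G P *
    (trainRisk F π (sgd F η w₁ π t j) + energy F η w₁ π t j / 2 -
      energyNoise α P G σ₀ * ∑ s ∈ range t, η (s + 1) ^ (1 + α / 2))) T ?_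
  · simpa [sgd, energy] using key
  intro t ht j
  set w := sgd F η w₁ π t j with hw
  set gm := gradient (trainRisk F π) w with hgm
  have hl : 0 < energyRate G P := by
    have := hP.1
    unfold energyRate; positivity
  have hno : 𝔼 i, ‖stochGrad F π w i‖ ≤ σ₀ ^ 2 ∨ 𝔼 i, ‖stochGrad F π w i - gm‖ ^ 2 ≤ σ₀ ^ 2 := by
    have := hnoise π t ht j
    simpa only [Fintype.expect_eq_sum_div_card, Fintype.card_fin, one_div_mul_eq_div] using this
  have step := expect_exp_energy_step (hη t).1 (hη t).2 hG hα hα1 hP.1 (stochGrad F π w) gm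
    (by rw [hgm, gradient_trainRisk hF, Fintype.card_fin]) (fun i => hgrad π t ht j _) hno
  have hwin : w ∈ Metric.closedBall w₁ r := hin π t ht.le j
  set A := trainRisk F π w + energy F η w₁ π t j / 2 -
      energyNoise α P G σ₀ * ∑ s ∈ range t, η (s + 1) ^ (1 + α / 2) with hA
  set B := η (t + 1) * ‖gm‖ ^ 2 / 2 - energyNoise α P G σ₀ * η (t + 1) ^ (1 + α / 2) with hB
  calc _ ≤ 𝔼 i, Real.exp (energyRate G P * (A + B)) * Real.exp (energyRate G P *
        (-inner ℝ gm (η (t + 1) • stochGrad F π w i) + P *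
          (max (‖η (t + 1) • stochGrad F π w i‖ ^ α) ‖η (t + 1) • stochGrad F π w i‖ *
            ‖η (t + 1) • stochGrad F π w i‖))) := by
        refine expect_le_expect fun i _ => ?_
        rw [← Real.exp_add, ← mul_add]
        refine Real.exp_le_exp.2 (mul_le_mul_of_nonneg_left ?_ hl.le)
        have hnext := hin π (t + 1) ht (Fin.snoc j i)
        rw [sgd_snoc] at hnext
        have hdesc := descent_le (differentiable_trainRisk hF π) (convex_closedBall w₁ r) hP.1 hα
          (trainRisk_holder hm hF hP π) hwin hnext
        rw [sgd_snoc, energy_snoc, sum_range_succ, mul_add]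
        linarith
    _ = Real.exp (energyRate G P * (A + B)) * _ := (mul_expect _ _ _).symm
    _ ≤ Real.exp (energyRate G P * (A + B)) * Real.exp (energyRate G P * (-(1 / 2) *
          (η (t + 1) * ‖gm‖ ^ 2) + energyNoise α P G σ₀ * η (t + 1) ^ (1 + α / 2))) :=
        mul_le_mul_of_nonneg_left step (Real.exp_pos _).le
    _ = _ := by rw [← Real.exp_add, ← mul_add]; congr 2; rw [hB]; ring

/-- The exponential supermartingale of Azuma's inequality for one coordinate of the displacement
without its drift. -/
theorem expect_exp_martingale_le (hm : 1 ≤ m) (hF : ∀ i, Differentiable ℝ (F.loss i))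
    (hη : ∀ t, 0 < η (t + 1)) (hgrad : BoundedGradients F η w₁ T G)
    (π : Equiv.Perm (Fin (m + u))) (κ : F.Index) (θ : ℝ) :
    𝔼 j : Fin T → Fin m, Real.exp (θ * (sgd F η w₁ π T j - w₁ + drift F η w₁ π T j) κ -
      2 * θ ^ 2 * G ^ 2 * ∑ s ∈ range T, η (s + 1)) ≤ 1 := by
  have : NeZero m := ⟨by omega⟩
  have key := expect_exp_le_of_step (m := m) (fun t j => θ * (sgd F η w₁ π t j - w₁ +
    drift F η w₁ π t j) κ - 2 * θ ^ 2 * G ^ 2 * ∑ s ∈ range t, η (s + 1)) T ?_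
  · simpa [sgd, drift] using key
  intro t ht j
  set w := sgd F η w₁ π t j with hw
  set gm := gradient (trainRisk F π) w with hgm
  set e := η (t + 1) with he
  have he0 : 0 < e := hη t
  set A := θ * (w - w₁ + drift F η w₁ π t j) κ - 2 * θ ^ 2 * G ^ 2 * ∑ s ∈ range t, η (s + 1)
  have hbd : ∀ i, |θ * -(e * stochGrad F π w i κ)| ≤ |θ| * (√e * G) := by
    intro i
    rw [abs_mul, abs_neg, abs_mul, abs_of_pos he0]
    have h1 : |stochGrad F π w i κ| ≤ ‖stochGrad F π w i‖ := by
      simpa using PiLp.norm_apply_le (stochGrad F π w i) κ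
    have h2 : √e * ‖stochGrad F π w i‖ ≤ G := hgrad π t ht j _
    have hsq : √e * √e = e := Real.mul_self_sqrt he0.le
    refine mul_le_mul_of_nonneg_left ?_ (abs_nonneg _)
    calc e * |stochGrad F π w i κ| ≤ e * ‖stochGrad F π w i‖ := by gcongr
      _ = √e * (√e * ‖stochGrad F π w i‖) := by rw [← mul_assoc, hsq]
      _ ≤ _ := by gcongr
  have hmean : 𝔼 i, θ * -(e * stochGrad F π w i κ) = -(θ * (e * gm κ)) := by
    rw [hgm, gradient_trainRisk hF, ← mul_expect, expect_neg_distrib, ← mul_expect,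
      Fintype.expect_eq_sum_div_card]
    simp [div_eq_inv_mul]
  have h1 := expect_exp_le_of_oscillation (fun i => θ * -(e * stochGrad F π w i κ))
    (2 * (|θ| * (√e * G))) (fun i k => (abs_sub _ _).trans (by linarith [hbd i, hbd k]))
  rw [hmean] at h1
  calc _ = 𝔼 i, Real.exp (A + θ * (e * gm κ) - 2 * θ ^ 2 * G ^ 2 * e) *
          Real.exp (θ * -(e * stochGrad F π w i κ)) := by
        refine expect_congr rfl fun i _ => ?_
        rw [← Real.exp_add, sgd_snoc, drift_snoc, sum_range_succ]
        congr 1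
        simp only [A, PiLp.add_apply, PiLp.sub_apply, PiLp.smul_apply, smul_eq_mul]
        ring
    _ = Real.exp (A + θ * (e * gm κ) - 2 * θ ^ 2 * G ^ 2 * e) * _ := (mul_expect _ _ _).symm
    _ ≤ _ := mul_le_mul_of_nonneg_left h1 (Real.exp_pos _).le
    _ = Real.exp A := by
        rw [← Real.exp_add]
        congr 1
        rw [mul_pow, mul_pow, mul_pow, sq_abs, Real.sq_sqrt he0.le]
        ring

theorem energyRate_pos (hG : 1 ≤ G) (hP : 0 ≤ P) : 0 < energyRate G P := by
  unfold energyRate; positivity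

theorem energyNoise_nonneg (hG : 1 ≤ G) (hP : 0 ≤ P) : 0 ≤ energyNoise α P G σ₀ := by
  unfold energyNoise; positivity

theorem stepSeries_nonneg (α : ℝ) : 0 ≤ stepSeries α := tsum_nonneg fun k => by positivity

theorem exp_neg_log {δ : ℝ} (hδ : 0 < δ) (k : ℕ) :
    Real.exp (-(k * Real.log (2 / δ))) = (δ / 2) ^ k := by
  rw [show -((k : ℝ) * Real.log (2 / δ)) = k * Real.log (δ / 2) by
    rw [← inv_div δ 2, Real.log_inv]; ring, Real.exp_nat_mul, Real.exp_log (by positivity)]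

theorem pr_energy_ge (hm : 1 ≤ m) (hF : ∀ i, Differentiable ℝ (F.loss i)) (hα : 0 < α)
    (hα1 : α ≤ 1) (ht₀ : 1 ≤ t₀) (hη : ∀ t, 1 ≤ t → η t = 1 / ((t : ℝ) + t₀)) (hG : 1 ≤ G)
    (hP : F.IsHolderSmooth α w₁ r P) (hin : StaysIn F η w₁ r T)
    (hgrad : BoundedGradients F η w₁ T G) (hnoise : BoundedNoise F η w₁ T σ₀)
    {b : ℝ} (hb : ∀ i, F.loss i w₁ ≤ b) (π : Equiv.Perm (Fin (m + u)))
    {δ : ℝ} (hδ : 0 < δ) (hδ1 : δ < 1) :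
    pr (fun j : Fin T → Fin m => 2 * (b + energyNoise α P G σ₀ * stepSeries α +
      2 * Real.log (2 / δ) * (1 / energyRate G P)) ≤ energy F η w₁ π T j) ≤ δ / 4 := by
  have hl := energyRate_pos hG hP.1
  have hη' : ∀ t, 0 < η (t + 1) ∧ η (t + 1) ≤ 1 := fun t => by
    rw [hη _ (by omega)]
    have : (0 : ℝ) ≤ (t + 1 : ℕ) := by positivity
    exact ⟨by positivity, by rw [div_le_one (by positivity)]; linarith⟩
  have h1 := pr_le_of_expect_exp_le _ (energyRate G P * b + 2 * Real.log (2 / δ)) _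
    (expect_exp_energy_le hm hF hα hα1 hη' hG hP hin hgrad hnoise π)
  have h2 : Real.exp (energyRate G P * trainRisk F π w₁ -
      (energyRate G P * b + 2 * Real.log (2 / δ))) ≤ δ / 4 := by
    have h3 : Real.exp (-(2 * Real.log (2 / δ))) = (δ / 2) ^ 2 := by
      exact_mod_cast exp_neg_log hδ 2
    refine (Real.exp_le_exp.2 (?_ : _ ≤ -(2 * Real.log (2 / δ)))).trans ?_
    · have := mul_le_mul_of_nonneg_left (trainRisk_le F hm π w₁ b hb) hl.le
      linarith
    · rw [h3]; nlinarith
  refine le_trans (pr_mono fun j hj => ?_) (h1.trans h2)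
  have h3 := trainRisk_nonneg F π (sgd F η w₁ π T j)
  have h4 := mul_le_mul_of_nonneg_left (sum_step_rpow_le hα ht₀ hη T)
    (energyNoise_nonneg (α := α) (σ₀ := σ₀) hG hP.1)
  have h5 : energyRate G P * b + 2 * Real.log (2 / δ) =
      energyRate G P * (b + 2 * Real.log (2 / δ) * (1 / energyRate G P)) := by
    field_simp
  rw [h5]
  refine mul_le_mul_of_nonneg_left ?_ hl.le
  linarith

theorem pr_martingale_ge (hm : 1 ≤ m) (hF : ∀ i, Differentiable ℝ (F.loss i)) (ht₀ : 1 ≤ t₀)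
    (hη : ∀ t, 1 ≤ t → η t = 1 / ((t : ℝ) + t₀)) (hT : 2 ≤ T)
    (hgrad : BoundedGradients F η w₁ T G) (π : Equiv.Perm (Fin (m + u)))
    {δ : ℝ} (hδ : 0 < δ) (hδ1 : δ < 1) :
    pr (fun j : Fin T → Fin m => Fintype.card F.Index * ((4 * G ^ 2 + (Fintype.card F.Index + 3)) *
      √(Real.log T * Real.log (2 / δ))) < ‖sgd F η w₁ π T j - w₁ + drift F η w₁ π T j‖) ≤
      δ / 4 := by
  set d := Fintype.card F.Index
  set Λ := Real.log (2 / δ)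
  have hΛ0 : 0 < Λ := Real.log_pos (by rw [lt_div_iff₀ hδ]; linarith)
  have hℒ0 : 0 < Real.log T := Real.log_pos (by exact_mod_cast hT)
  set ℒ := Real.log T
  set y := (4 * G ^ 2 + ((d : ℝ) + 3)) * √(ℒ * Λ) with hy
  set M := fun j : Fin T → Fin m => sgd F η w₁ π T j - w₁ + drift F η w₁ π T j with hM
  have hη0 : ∀ t, 0 < η (t + 1) := fun t => by rw [hη _ (by omega)]; positivity
  have hS : ∑ s ∈ range T, η (s + 1) ≤ 2 * ℒ := sum_step_le ht₀ hη hT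
  -- both signs of `θ` with `θ² = log(2/δ) / log T`, the exponent that balances the Azuma bound
  have hcoord : ∀ (κ : F.Index) (θ : ℝ), θ ^ 2 = Λ / ℒ →
      pr (fun j => |θ| * y ≤ θ * M j κ) ≤ (δ / 2) ^ (d + 3) := by
    intro κ θ hθ
    have h1 := pr_le_of_expect_exp_le _ (((d + 3 : ℕ) : ℝ) * Λ) 0
      ((expect_exp_martingale_le hm hF hη0 hgrad π κ θ).trans (by simp))
    rw [zero_sub, exp_neg_log hδ] at h1
    refine le_trans (pr_mono fun j hj => ?_) h1
    have h2 : |θ| * y = (4 * G ^ 2 + ((d : ℝ) + 3)) * Λ := by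
      rw [← Real.sqrt_sq_eq_abs, hθ, hy, mul_left_comm, ← Real.sqrt_mul (by positivity),
        show Λ / ℒ * (ℒ * Λ) = Λ ^ 2 by field_simp, Real.sqrt_sq hΛ0.le]
    have h3 : 2 * θ ^ 2 * G ^ 2 * ∑ s ∈ range T, η (s + 1) ≤ 4 * G ^ 2 * Λ := by
      calc _ ≤ 2 * θ ^ 2 * G ^ 2 * (2 * ℒ) := by gcongr
        _ = _ := by rw [hθ]; field_simp; ring
    rw [h2] at hj
    push_cast
    have h4 : (4 * G ^ 2 + ((d : ℝ) + 3)) * Λ = 4 * G ^ 2 * Λ + (d + 3) * Λ := by ring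
    change _ ≤ θ * M j κ - _
    linarith
  have hθ0 : 0 < √(Λ / ℒ) := Real.sqrt_pos.2 (by positivity)
  have hsub : pr (fun j => d * y < ‖M j‖) ≤ pr (fun j => ∃ κ ∈ (univ : Finset F.Index),
      (|√(Λ / ℒ)| * y ≤ √(Λ / ℒ) * M j κ ∨ |-√(Λ / ℒ)| * y ≤ -√(Λ / ℒ) * M j κ)) := by
    refine pr_mono fun j hj => ?_
    by_contra hcon
    push Not at hcon
    refine absurd (norm_le_card_mul (M j) y fun κ => ?_) (not_le.2 hj)
    obtain ⟨h2, h3⟩ := hcon κ (mem_univ κ)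
    rw [abs_neg] at h3
    rw [abs_of_pos hθ0] at h2 h3
    rw [neg_mul, ← mul_neg] at h3
    have h4 := lt_of_mul_lt_mul_left h2 hθ0.le
    have h5 := lt_of_mul_lt_mul_left h3 hθ0.le
    exact abs_le.2 ⟨by linarith, h4.le⟩
  refine hsub.trans ((pr_exists_le _ _).trans ?_)
  have hsq : √(Λ / ℒ) ^ 2 = Λ / ℒ := Real.sq_sqrt (by positivity)
  calc _ ≤ ∑ κ : F.Index, ((δ / 2) ^ (d + 3) + (δ / 2) ^ (d + 3)) :=
        sum_le_sum fun κ _ => (pr_or_le _ _).trans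
          (add_le_add (hcoord κ _ hsq) (hcoord κ _ (by rw [neg_sq, hsq])))
    _ = 2 * d * (δ / 2) ^ (d + 3) := by
        rw [sum_const, card_univ, nsmul_eq_mul]; ring
    _ ≤ 2 * d * (δ / 2 * (1 / 2) ^ (d + 2)) := by
        have : (δ / 2) ^ (d + 2) ≤ (1 / 2) ^ (d + 2) :=
          pow_le_pow_left₀ (by positivity) (by linarith) _
        rw [show d + 3 = (d + 2) + 1 by ring, pow_succ' (δ / 2)]
        gcongr
    _ = δ / 4 * (d * (1 / 2) ^ d) := by ring
    _ ≤ δ / 4 * 1 := by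
        have h1 : (d : ℝ) ≤ 2 ^ d := by exact_mod_cast (Nat.lt_two_pow_self (n := d)).le
        gcongr
        rw [one_div, inv_pow, ← div_eq_mul_inv]
        exact div_le_one_of_le₀ h1 (by positivity)
    _ = δ / 4 := mul_one _

/-- The constant in the bound for the distance travelled by the iterates. -/
noncomputable def radiusConst (d : ℕ) (α P b G σ₀ : ℝ) : ℝ :=
  d * (4 * G ^ 2 + (d + 3)) +
    √(8 * (b + energyNoise α P G σ₀ * stepSeries α + 1 / energyRate G P)) + 2

theorem two_le_radiusConst (d : ℕ) (α P b G σ₀ : ℝ) : 2 ≤ radiusConst d α P b G σ₀ := by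
  unfold radiusConst
  have : 0 ≤ (d : ℝ) * (4 * G ^ 2 + (d + 3)) := by positivity
  linarith [Real.sqrt_nonneg (8 * (b + energyNoise α P G σ₀ * stepSeries α + 1 / energyRate G P))]

/-- With probability at least `1 - δ / 2` over the draws, the last iterate is within a distance of
order `√(log T · log(2/δ))` of the initial parameter, for every split `π`. -/
theorem pr_norm_sgd_sub_gt (hm : 1 ≤ m) (hF : ∀ i, Differentiable ℝ (F.loss i)) (hα : 0 < α)
    (hα1 : α ≤ 1) (ht₀ : 1 ≤ t₀) (hη : ∀ t, 1 ≤ t → η t = 1 / ((t : ℝ) + t₀)) (hT : 2 ≤ T)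
    (hG : 1 ≤ G) (hP : F.IsHolderSmooth α w₁ r P) (hin : StaysIn F η w₁ r T)
    (hgrad : BoundedGradients F η w₁ T G) (hnoise : BoundedNoise F η w₁ T σ₀)
    {b : ℝ} (hb0 : 0 ≤ b) (hb : ∀ i, F.loss i w₁ ≤ b) (π : Equiv.Perm (Fin (m + u)))
    {δ : ℝ} (hδ : 0 < δ) (hδ1 : δ < 1) :
    pr (fun j : Fin T → Fin m => radiusConst (Fintype.card F.Index) α P b G σ₀ *
      √(Real.log T * Real.log (2 / δ)) < ‖sgd F η w₁ π T j - w₁‖) ≤ δ / 2 := by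
  have h1 := pr_energy_ge hm hF hα hα1 ht₀ hη hG hP hin hgrad hnoise hb π hδ hδ1
  have h2 := pr_martingale_ge hm hF ht₀ hη hT hgrad π hδ hδ1
  refine le_trans (pr_mono fun j hj => ?_) ((pr_or_le _ _).trans ((add_le_add h1 h2).trans ?_))
  swap
  · linarith
  by_contra hcon
  push Not at hcon
  obtain ⟨hE, hM⟩ := hcon
  refine absurd hj (not_lt.2 ?_)
  have hΛ0 : 1 / 2 ≤ Real.log (2 / δ) := by
    have h3 : Real.log 2 ≤ Real.log (2 / δ) :=
      Real.log_le_log (by norm_num) (by rw [le_div_iff₀ hδ]; linarith)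
    linarith [Real.log_two_gt_d9]
  set Λ := Real.log (2 / δ)
  have hℒ0 : 0 < Real.log T := Real.log_pos (by exact_mod_cast hT)
  have hl := energyRate_pos hG hP.1
  have hnn := mul_nonneg (energyNoise_nonneg (α := α) (σ₀ := σ₀) hG hP.1) (stepSeries_nonneg α)
  have hη0 : ∀ t, 0 ≤ η (t + 1) := fun t => by rw [hη _ (by omega)]; positivity
  obtain ⟨he0, hD⟩ := norm_drift_sq_le F η w₁ π hη0 T j
  have hDn : ‖drift F η w₁ π T j‖ ≤ √(8 * (b + energyNoise α P G σ₀ * stepSeries α +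
      1 / energyRate G P)) * √(Real.log T * Λ) := by
    rw [← Real.sqrt_mul (by positivity)]
    refine Real.le_sqrt_of_sq_le (hD.trans ?_)
    calc _ ≤ 2 * Real.log T * (2 * (b + energyNoise α P G σ₀ * stepSeries α +
          2 * Λ * (1 / energyRate G P))) := by
          refine mul_le_mul (sum_step_le ht₀ hη hT) hE.le he0 (by positivity)
      _ ≤ 2 * Real.log T * (2 * (2 * Λ * b + 2 * Λ * (energyNoise α P G σ₀ * stepSeries α) +
          2 * Λ * (1 / energyRate G P))) := by
          have h4 : b ≤ 2 * Λ * b := le_mul_of_one_le_left hb0 (by linarith)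
          have h5 := le_mul_of_one_le_left hnn (show 1 ≤ 2 * Λ by linarith)
          exact mul_le_mul_of_nonneg_left (by linarith) (by positivity)
      _ = _ := by ring
  have h3 : sgd F η w₁ π T j - w₁ =
      (sgd F η w₁ π T j - w₁ + drift F η w₁ π T j) - drift F η w₁ π T j := by abel
  rw [h3]
  refine (norm_sub_le _ _).trans ((add_le_add hM hDn).trans ?_)
  unfold radiusConst
  nlinarith [Real.sqrt_nonneg (Real.log T * Λ)]

end Tails

/-! ### Hölder smoothness of the loss -/

section Holder

variable {E V : Type*} [NormedAddCommGroup E] [NormedAddCommGroup V]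

/-- `f` is `α`-Hölder continuous on every ball around the origin. -/
def HolderOnBalls (α : ℝ) (f : E → V) : Prop :=
  ∀ R : ℝ, ∃ C : ℝ, 0 ≤ C ∧ ∀ w w' : E, ‖w‖ ≤ R → ‖w'‖ ≤ R → ‖f w - f w'‖ ≤ C * ‖w - w'‖ ^ α

theorem HolderOnBalls.const (α : ℝ) (c : V) : HolderOnBalls α fun _ : E => c :=
  fun _ => ⟨0, le_rfl, fun w w' _ _ => by simp⟩

theorem HolderOnBalls.add {α : ℝ} {f g : E → V} (hf : HolderOnBalls α f) (hg : HolderOnBalls α g) :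
    HolderOnBalls α fun w => f w + g w := by
  intro R
  obtain ⟨C, hC, h⟩ := hf R
  obtain ⟨C', hC', h'⟩ := hg R
  refine ⟨C + C', by positivity, fun w w' hw hw' => ?_⟩
  rw [add_sub_add_comm, add_mul]
  exact (norm_add_le _ _).trans (add_le_add (h w w' hw hw') (h' w w' hw hw'))

theorem HolderOnBalls.bounded {α : ℝ} (hα : 0 < α) {f : E → V} (hf : HolderOnBalls α f) (R : ℝ) :
    ∃ M, 0 ≤ M ∧ ∀ w, ‖w‖ ≤ R → ‖f w‖ ≤ M := by
  obtain ⟨C, hC, h⟩ := hf R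
  refine ⟨‖f 0‖ + C * |R| ^ α, by positivity, fun w hw => ?_⟩
  have hR : 0 ≤ R := (norm_nonneg w).trans hw
  have h1 := h w 0 hw (by simpa using hR)
  rw [sub_zero] at h1
  have h2 : ‖f w‖ ≤ ‖f w - f 0‖ + ‖f 0‖ := by simpa using norm_add_le (f w - f 0) (f 0)
  have h3 : C * ‖w‖ ^ α ≤ C * |R| ^ α := by
    rw [abs_of_nonneg hR]; gcongr
  linarith

variable [NormedSpace ℝ V]

theorem HolderOnBalls.smul {α : ℝ} (hα : 0 < α) {f : E → ℝ} {g : E → V} (hf : HolderOnBalls α f)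
    (hg : HolderOnBalls α g) : HolderOnBalls α fun w => f w • g w := by
  intro R
  obtain ⟨C, hC, h⟩ := hf R
  obtain ⟨C', hC', h'⟩ := hg R
  obtain ⟨M, hM, hfM⟩ := hf.bounded hα R
  obtain ⟨M', hM', hgM⟩ := hg.bounded hα R
  refine ⟨M * C' + C * M', by positivity, fun w w' hw hw' => ?_⟩
  have h1 : f w • g w - f w' • g w' = f w • (g w - g w') + (f w - f w') • g w' := by
    rw [smul_sub, sub_smul]; abel
  rw [h1]
  refine (norm_add_le _ _).trans ?_
  rw [norm_smul, norm_smul, add_mul]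
  refine add_le_add ?_ ?_
  · rw [mul_assoc]
    exact mul_le_mul (hfM w hw) (h' w w' hw hw') (norm_nonneg _) hM
  · rw [mul_right_comm]
    exact mul_le_mul (h w w' hw hw') (hgM w' hw') (norm_nonneg _) (by positivity)

variable [NormedSpace ℝ E]

theorem exists_lipschitz_on_balls [FiniteDimensional ℝ E] {f : E → V} (hf : ContDiff ℝ 1 f)
    (R : ℝ) : ∃ C : ℝ, 0 ≤ C ∧ ∀ w w' : E, ‖w‖ ≤ R → ‖w'‖ ≤ R → ‖f w - f w'‖ ≤ C * ‖w - w'‖ := by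
  have : ProperSpace E := FiniteDimensional.proper ℝ E
  obtain ⟨C, hC⟩ := (isCompact_closedBall (0 : E) R).exists_bound_of_continuousOn
    (hf.continuous_fderiv one_ne_zero).continuousOn
  refine ⟨|C|, abs_nonneg _, fun w w' hw hw' => ?_⟩
  exact (convex_closedBall (0 : E) R).norm_image_sub_le_of_norm_fderiv_le (𝕜 := ℝ)
    (fun x _ => (hf.differentiable one_ne_zero) x) (fun x hx => (hC x hx).trans (le_abs_self _))
    (by simpa using hw') (by simpa using hw)

theorem HolderOnBalls.of_contDiff [FiniteDimensional ℝ E] {α : ℝ} (hα : 0 < α) (hα1 : α ≤ 1)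
    {f : E → V} (hf : ContDiff ℝ 1 f) : HolderOnBalls α f := by
  intro R
  obtain ⟨C, hC, h⟩ := exists_lipschitz_on_balls hf R
  refine ⟨C * |2 * R| ^ (1 - α), by positivity, fun w w' hw hw' => (h w w' hw hw').trans ?_⟩
  have hR : 0 ≤ R := (norm_nonneg w).trans hw
  rcases (norm_nonneg (w - w')).eq_or_lt with h0 | h0
  · rw [← h0]; simp [Real.zero_rpow hα.ne']
  rw [mul_assoc]
  gcongr
  calc ‖w - w'‖ = ‖w - w'‖ ^ (1 - α) * ‖w - w'‖ ^ α := by rw [← Real.rpow_add h0]; simp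
    _ ≤ _ := by
      rw [abs_of_nonneg (by positivity)]
      have h1 : ‖w - w'‖ ≤ 2 * R := (norm_sub_le _ _).trans (by linarith)
      gcongr

/-- `f` is continuously differentiable and its derivative is `α`-Hölder on balls. -/
def HolderC1 (α : ℝ) (f : E → ℝ) : Prop := ContDiff ℝ 1 f ∧ HolderOnBalls α (fderiv ℝ f)

variable {α : ℝ} {f g : E → ℝ}

theorem HolderC1.const (α : ℝ) (c : ℝ) : HolderC1 α fun _ : E => c :=
  ⟨contDiff_const, by
    rw [fderiv_fun_const]
    exact HolderOnBalls.const α (0 : E →L[ℝ] ℝ)⟩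

theorem HolderC1.clm (α : ℝ) (L : E →L[ℝ] ℝ) : HolderC1 α L :=
  ⟨L.contDiff, by
    have : fderiv ℝ (L : E → ℝ) = fun _ => L := by ext1 x; exact L.fderiv
    rw [this]
    exact HolderOnBalls.const α L⟩

theorem HolderC1.add (hf : HolderC1 α f) (hg : HolderC1 α g) : HolderC1 α fun w => f w + g w := by
  refine ⟨hf.1.add hg.1, ?_⟩
  have : fderiv ℝ (fun w => f w + g w) = fun w => fderiv ℝ f w + fderiv ℝ g w := by
    ext1 w
    exact fderiv_fun_add (hf.1.differentiable one_ne_zero w) (hg.1.differentiable one_ne_zero w)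
  rw [this]
  exact hf.2.add hg.2

theorem HolderC1.sum {κ : Type*} (s : Finset κ) {f : κ → E → ℝ} (hf : ∀ i, HolderC1 α (f i)) :
    HolderC1 α fun w => ∑ i ∈ s, f i w := by
  classical
  induction s using Finset.induction_on with
  | empty => simpa using HolderC1.const α 0
  | insert a s ha ih => simp_rw [sum_insert ha]; exact (hf a).add ih

variable [FiniteDimensional ℝ E]

theorem HolderC1.mul (hα : 0 < α) (hα1 : α ≤ 1) (hf : HolderC1 α f) (hg : HolderC1 α g) :
    HolderC1 α fun w => f w * g w := by
  refine ⟨hf.1.mul hg.1, ?_⟩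
  have : fderiv ℝ (fun w => f w * g w) = fun w => f w • fderiv ℝ g w + g w • fderiv ℝ f w := by
    ext1 w
    exact fderiv_fun_mul (hf.1.differentiable one_ne_zero w) (hg.1.differentiable one_ne_zero w)
  rw [this]
  exact ((HolderOnBalls.of_contDiff hα hα1 hf.1).smul hα hg.2).add
    ((HolderOnBalls.of_contDiff hα hα1 hg.1).smul hα hf.2)

theorem HolderC1.exp (hα : 0 < α) (hα1 : α ≤ 1) (hf : HolderC1 α f) :
    HolderC1 α fun w => Real.exp (f w) := by
  refine ⟨hf.1.exp, ?_⟩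
  have : fderiv ℝ (fun w => Real.exp (f w)) = fun w => Real.exp (f w) • fderiv ℝ f w := by
    ext1 w
    exact fderiv_exp (hf.1.differentiable one_ne_zero w)
  rw [this]
  exact (HolderOnBalls.of_contDiff hα hα1 hf.1.exp).smul hα hf.2

theorem HolderC1.log (hα : 0 < α) (hα1 : α ≤ 1) (hf : HolderC1 α f) (hpos : ∀ w, 0 < f w) :
    HolderC1 α fun w => Real.log (f w) := by
  have h0 : ∀ w, f w ≠ 0 := fun w => (hpos w).ne'
  refine ⟨hf.1.log h0, ?_⟩
  have : fderiv ℝ (fun w => Real.log (f w)) = fun w => (f w)⁻¹ • fderiv ℝ f w := by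
    ext1 w
    exact fderiv.log (hf.1.differentiable one_ne_zero w) (h0 w)
  rw [this]
  exact (HolderOnBalls.of_contDiff hα hα1 (hf.1.inv h0)).smul hα hf.2

/-- The chain rule: `σ' ∘ f` is `α`-Hölder on balls because `f` is Lipschitz there. -/
theorem HolderC1.comp (hα : 0 < α) (hf : HolderC1 α f) {σ : ℝ → ℝ} {P : ℝ}
    (hP : 0 ≤ P) (hσ : Differentiable ℝ σ)
    (hσ' : ∀ x y : ℝ, |deriv σ x - deriv σ y| ≤ P * |x - y| ^ α) :
    HolderC1 α fun w => σ (f w) := by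
  have hcont : Continuous (deriv σ) := by
    rw [continuous_iff_continuousAt]
    intro x
    rw [ContinuousAt, tendsto_iff_norm_sub_tendsto_zero]
    refine squeeze_zero (fun _ => norm_nonneg _) (fun y => hσ' y x) ?_
    have : Continuous fun y : ℝ => P * |y - x| ^ α := by
      refine continuous_const.mul (Continuous.rpow_const (by fun_prop) fun y => Or.inr hα.le)
    have h := this.tendsto x
    simpa [Real.zero_rpow hα.ne'] using h
  have hσ1 : ContDiff ℝ 1 σ := contDiff_one_iff_deriv.2 ⟨hσ, hcont⟩
  refine ⟨hσ1.comp hf.1, ?_⟩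
  have : fderiv ℝ (fun w => σ (f w)) = fun w => deriv σ (f w) • fderiv ℝ f w := by
    ext1 w
    exact ((hσ (f w)).hasDerivAt.comp_hasFDerivAt w
      (hf.1.differentiable one_ne_zero w).hasFDerivAt).fderiv
  rw [this]
  refine HolderOnBalls.smul hα (fun R => ?_) hf.2
  obtain ⟨C, hC, h⟩ := exists_lipschitz_on_balls hf.1 R
  refine ⟨P * C ^ α, by positivity, fun w w' hw hw' => ?_⟩
  calc ‖deriv σ (f w) - deriv σ (f w')‖ ≤ P * |f w - f w'| ^ α := hσ' _ _
    _ ≤ P * (C * ‖w - w'‖) ^ α := by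
        gcongr
        exact h w w' hw hw'
    _ = _ := by rw [Real.mul_rpow hC (norm_nonneg _)]; ring

end Holder

namespace Problem

variable {n : ℕ} {F : Problem n} {α P : ℝ}

theorem holderC1_weight (α : ℝ) (h : Fin F.H) (i : Fin (F.rows h)) (j : Fin (F.cols h)) :
    HolderC1 α fun w : F.Param => F.weight w h i j :=
  HolderC1.clm α (EuclideanSpace.proj (𝕜 := ℝ) (⟨h, (i, j)⟩ : F.Index))

theorem holderC1_eval (hα : 0 < α) (hα1 : α ≤ 1) (hP : 0 ≤ P) (hσ : F.HolderActivation α P) :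
    ∀ {c : ℕ} (Z : Net n F.H F.rows F.cols F.p c) (i : Fin n) (k : Fin c),
      HolderC1 α fun w => F.eval w Z i k
  | _, .input, i, k => by simpa only [eval] using HolderC1.const α (F.X i k)
  | _, .propagate g Z, i, k => by
    simp only [eval, Matrix.mul_apply]
    exact HolderC1.sum _ fun l => (HolderC1.const α _).mul hα hα1
      (holderC1_eval hα hα1 hP hσ Z l k)
  | _, .linear h Z, i, k => by
    simp only [eval, Matrix.mul_apply]
    exact HolderC1.sum _ fun l => (holderC1_eval hα hα1 hP hσ Z i l).mul hα hα1
      (holderC1_weight α h l k)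
  | _, .smul a Z, i, k => by
    simp only [eval, Matrix.smul_apply, smul_eq_mul]
    exact (HolderC1.const α a).mul hα hα1 (holderC1_eval hα hα1 hP hσ Z i k)
  | _, .scale h a b Z, i, k => by
    simp only [eval, Matrix.smul_apply, smul_eq_mul]
    exact (holderC1_weight α h a b).mul hα hα1 (holderC1_eval hα hα1 hP hσ Z i k)
  | _, .add Z Z', i, k => by
    simp only [eval, Matrix.add_apply]
    exact (holderC1_eval hα hα1 hP hσ Z i k).add (holderC1_eval hα hα1 hP hσ Z' i k)
  | _, .act Z, i, k => by
    simp only [eval, Matrix.map_apply]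
    exact (holderC1_eval hα hα1 hP hσ Z i k).comp hα hP hσ.1 hσ.2

theorem holderC1_loss (hα : 0 < α) (hα1 : α ≤ 1) (hP : 0 ≤ P) (hσ : F.HolderActivation α P)
    (i : Fin n) : HolderC1 α (F.loss i) := by
  have hpos : ∀ w : F.Param, 0 < ∑ l : Fin F.K, Real.exp (F.eval w F.net i l) := fun w =>
    sum_pos (fun _ _ => Real.exp_pos _) ⟨F.y i, mem_univ _⟩
  have h1 : F.loss i = fun w => Real.log (∑ l : Fin F.K, Real.exp (F.eval w F.net i l)) +
      (-1) * F.eval w F.net i (F.y i) := by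
    ext w
    rw [loss, predict, Real.log_div (Real.exp_pos _).ne' (hpos w).ne', Real.log_exp]
    ring
  rw [h1]
  exact (HolderC1.log hα hα1 (HolderC1.sum _ fun l => (holderC1_eval hα hα1 hP hσ _ i l).exp hα hα1)
    hpos).add ((HolderC1.const α (-1)).mul hα hα1 (holderC1_eval hα hα1 hP hσ _ i _))

theorem differentiable_loss (hα : 0 < α) (hα1 : α ≤ 1) (hP : 0 ≤ P) (hσ : F.HolderActivation α P)
    (i : Fin n) : Differentiable ℝ (F.loss i) :=
  (holderC1_loss hα hα1 hP hσ i).1.differentiable one_ne_zero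

theorem exists_isHolderSmooth (hα : 0 < α) (hα1 : α ≤ 1) (hP : 0 ≤ P) (hσ : F.HolderActivation α P)
    (w₁ : F.Param) (r : ℝ) : ∃ P₀, F.IsHolderSmooth α w₁ r P₀ := by
  choose C hC h using fun i => (holderC1_loss hα hα1 hP hσ i).2 (‖w₁‖ + r)
  have hball : ∀ w ∈ Metric.closedBall w₁ r, ‖w‖ ≤ ‖w₁‖ + r := fun w hw => by
    have h1 : ‖w‖ ≤ ‖w₁‖ + ‖w - w₁‖ := by simpa using norm_add_le w₁ (w - w₁)
    have h2 := mem_closedBall_iff_norm.1 hw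
    linarith
  refine ⟨∑ i, C i, sum_nonneg fun i _ => hC i, fun i w hw w' hw' => ?_⟩
  have h1 : ‖gradient (F.loss i) w - gradient (F.loss i) w'‖ =
      ‖fderiv ℝ (F.loss i) w - fderiv ℝ (F.loss i) w'‖ := by
    rw [← toDual_gradient, ← toDual_gradient, ← map_sub, LinearIsometryEquiv.norm_map]
  rw [h1]
  refine (h i w w' (hball w hw) (hball w' hw')).trans ?_
  exact mul_le_mul (single_le_sum (f := C) (fun i _ => hC i) (mem_univ i)) (le_max_left _ _)
    (by positivity) (sum_nonneg fun i _ => hC i)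

/-- The infimum that defines `P_F` is attained. -/
theorem isHolderSmooth_holderConst (hα : 0 < α) (hα1 : α ≤ 1) (hP : 0 ≤ P)
    (hσ : F.HolderActivation α P) (w₁ : F.Param) (r : ℝ) :
    F.IsHolderSmooth α w₁ r (F.holderConst α w₁ r) := by
  obtain ⟨P₀, hP₀⟩ := exists_isHolderSmooth hα hα1 hP hσ w₁ r
  have hne : {P₀ | F.IsHolderSmooth α w₁ r P₀}.Nonempty := ⟨P₀, hP₀⟩
  refine ⟨le_csInf hne fun _ h => h.1, fun i w hw w' hw' => ?_⟩
  set M := max (‖w - w'‖ ^ α) ‖w - w'‖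
  have hM : 0 ≤ M := le_max_of_le_right (norm_nonneg _)
  rcases hM.eq_or_lt with h0 | h0
  · have h1 : _ ≤ P₀ * M := hP₀.2 i w hw w' hw'
    rw [← h0, mul_zero] at h1 ⊢
    exact h1
  · rw [← div_le_iff₀ h0]
    refine le_csInf hne fun P₁ h => ?_
    rw [div_le_iff₀ h0]
    exact h.2 i w hw w' hw'

theorem card_index : Fintype.card F.Index = F.numParams := by
  simp [numParams]

end Problem

/-! ### The gradient gap -/

/-- All three rates dominate `√(log T)`, up to the factor `√(log 2)` that is needed for `α = 1 / 2`. -/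
theorem sqrt_log_le_rate {α : ℝ} {T : ℕ} (hT : 2 ≤ T) :
    √(Real.log 2) * √(Real.log T) ≤ rate α T := by
  have hT' : (2 : ℝ) ≤ T := by exact_mod_cast hT
  have h2 : Real.log 2 ≤ Real.log T := Real.log_le_log (by norm_num) hT'
  have h1 : √(Real.log 2) ≤ 1 :=
    Real.sqrt_le_one.2 (by linarith [Real.log_two_lt_d9])
  have h3 : √(Real.log 2) * √(Real.log T) ≤ √(Real.log T) :=
    mul_le_of_le_one_left (Real.sqrt_nonneg _) h1
  unfold rate
  split_ifs with ha hb
  · refine h3.trans (le_mul_of_one_le_right (Real.sqrt_nonneg _) ?_)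
    exact Real.one_le_rpow (by linarith) (by linarith)
  · calc √(Real.log 2) * √(Real.log T) ≤ √(Real.log T) * √(Real.log T) := by gcongr
      _ = Real.log T := Real.mul_self_sqrt (by
        have := Real.log_nonneg (show (1 : ℝ) ≤ 2 by norm_num)
        linarith)
  · exact h3

/-- The constant of the generalization bound for the gradients. -/
noncomputable def gapConst (d : ℕ) (α P bg bl G σ₀ : ℝ) : ℝ :=
  chainConst d α * (bg + P + 1) * radiusConst d α P bl (G + 1) σ₀ / √(Real.log 2)

theorem gradGap_eq {m u : ℕ} {F : Problem (m + u)} (hF : ∀ i, Differentiable ℝ (F.loss i))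
    (η : ℕ → ℝ) (w₁ : F.Param) {T : ℕ} (ω : Outcome m u T) :
    gradGap F η w₁ ω =
      ‖splitGap ω.1 (fun i => gradient (F.loss i) (sgd F η w₁ ω.1 T ω.2))‖ := by
  rw [gradGap, gradient_trainRisk hF, gradient_testRisk hF]
  rfl

/-- The last iterate lies in the ball of radius `min R r`, on which the gap is uniformly small, off
two events of probability at most `δ / 2`. -/
theorem pr_gradGap_gt {m u : ℕ} (hm : 1 ≤ m) (hu : 1 ≤ u) {F : Problem (m + u)}
    (hF : ∀ i, Differentiable ℝ (F.loss i)) {η : ℕ → ℝ} {w₁ : F.Param}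
    {r t₀ α P G σ₀ : ℝ} {T : ℕ} (hr : 1 ≤ r) (hα : 0 < α) (hα1 : α ≤ 1) (ht₀ : 1 ≤ t₀)
    (hη : ∀ t, 1 ≤ t → η t = 1 / ((t : ℝ) + t₀)) (hT : 2 ≤ T) (hG : 0 < G)
    (hP : F.IsHolderSmooth α w₁ r P) (hin : StaysIn F η w₁ r T)
    (hgrad : BoundedGradients F η w₁ T G) (hnoise : BoundedNoise F η w₁ T σ₀)
    {δ : ℝ} (hδ : 0 < δ) (hδ1 : δ < 1) :
    pr (fun ω : Outcome m u T =>
      gapConst F.numParams α P (F.gradBound w₁) (F.lossBound w₁) G σ₀ * splitScale m u *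
        rate α T * Real.log (2 / δ) < gradGap F η w₁ ω) ≤ δ := by
  have : NeZero m := ⟨by omega⟩
  rw [← Problem.card_index]
  set d := Fintype.card F.Index
  set bg := F.gradBound w₁
  set bl := F.lossBound w₁
  have hbg : ∀ i, ‖gradient (F.loss i) w₁‖ ≤ bg := fun i =>
    le_ciSup (f := fun i => ‖gradient (F.loss i) w₁‖) (Set.finite_range _).bddAbove i
  have hbl : ∀ i, |F.loss i w₁| ≤ bl := fun i =>
    le_ciSup (f := fun i => |F.loss i w₁|) (Set.finite_range _).bddAbove i
  have i₀ : Fin (m + u) := ⟨0, by omega⟩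
  have hbg0 : 0 ≤ bg := (norm_nonneg _).trans (hbg i₀)
  have hbl0 : 0 ≤ bl := (abs_nonneg _).trans (hbl i₀)
  have hP0 := hP.1
  have hgrad' : BoundedGradients F η w₁ T (G + 1) := fun π t ht j i =>
    (hgrad π t ht j i).trans (by linarith)
  have hlog2 : 1 / 2 ≤ Real.log 2 := by linarith [Real.log_two_gt_d9]
  have hΛ0 : 1 / 2 ≤ Real.log (2 / δ) :=
    hlog2.trans (Real.log_le_log (by norm_num) (by rw [le_div_iff₀ hδ]; linarith))
  have hℒ0 : 1 / 2 ≤ Real.log T :=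
    hlog2.trans (Real.log_le_log (by norm_num) (by exact_mod_cast hT))
  set CR := radiusConst d α P bl (G + 1) σ₀ with hCR
  set R := CR * √(Real.log T * Real.log (2 / δ)) with hR
  have hCR2 : 2 ≤ CR := two_le_radiusConst d α P bl (G + 1) σ₀
  have hR1 : 1 ≤ R := by
    have h1 : 1 / 2 ≤ √(Real.log T * Real.log (2 / δ)) := Real.le_sqrt_of_sq_le (by nlinarith)
    nlinarith
  have hball := pr_exists_splitGap_gt hm hu (fun i => gradient (F.loss i)) w₁
    (ρ := min R r) (R := R) (B := bg + P + 1) (by positivity) (min_le_left _ _) hR1 (by positivity)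
    hα hα1 (fun i => (hbg i).trans (by linarith)) (fun i w w' hw hw' =>
      (hP.2 i w (mem_closedBall_iff_norm.2 (hw.trans (min_le_right _ _))) w'
        (mem_closedBall_iff_norm.2 (hw'.trans (min_le_right _ _)))).trans
        (mul_le_mul_of_nonneg_right (by linarith) (le_max_of_le_right (norm_nonneg _)))) hδ hδ1
  have hrad : pr (fun ω : Outcome m u T => R < ‖sgd F η w₁ ω.1 T ω.2 - w₁‖) ≤ δ / 2 :=
    pr_prod_le _ _ fun π => pr_norm_sgd_sub_gt hm hF hα hα1 ht₀ hη hT (by linarith) hP hin hgrad'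
      hnoise hbl0 (fun i => (le_abs_self _).trans (hbl i)) π hδ hδ1
  have hs := splitScale_pos hm hu
  refine le_trans (pr_mono fun ω hω => ?_) ((pr_or_le _ _).trans
    ((add_le_add hrad ((pr_comp_fst_le (Ω' := Fin T → Fin m) _).trans hball)).trans
      (by linarith)))
  by_contra hcon
  push Not at hcon
  obtain ⟨h1, h2⟩ := hcon
  have h3 := h2 (sgd F η w₁ ω.1 T ω.2)
    (le_min h1 (mem_closedBall_iff_norm.1 (hin ω.1 T le_rfl ω.2)))
  rw [← gradGap_eq hF] at h3
  refine absurd (h3.trans ?_) (not_le.2 hω)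
  have hsqrt : √(Real.log T * Real.log (2 / δ)) * √(Real.log (2 / δ)) =
      √(Real.log T) * Real.log (2 / δ) := by
    rw [Real.sqrt_mul (by linarith), mul_assoc, Real.mul_self_sqrt (by linarith)]
  have hpos : 0 < √(Real.log 2) := Real.sqrt_pos.2 (by linarith)
  have hrate : √(Real.log T) ≤ rate α T / √(Real.log 2) := by
    rw [le_div_iff₀ hpos, mul_comm]; exact sqrt_log_le_rate hT
  have hc := chainConst_nonneg d α
  calc chainConst d α * splitScale m u * (bg + P + 1) * R * √(Real.log (2 / δ))
      = chainConst d α * splitScale m u * (bg + P + 1) * CR *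
          (√(Real.log T * Real.log (2 / δ)) * √(Real.log (2 / δ))) := by rw [hR]; ring
    _ = chainConst d α * splitScale m u * (bg + P + 1) * CR *
          (√(Real.log T) * Real.log (2 / δ)) := by rw [hsqrt]
    _ ≤ chainConst d α * splitScale m u * (bg + P + 1) * CR *
          (rate α T / √(Real.log 2) * Real.log (2 / δ)) := by gcongr
    _ = _ := by rw [gapConst, ← hCR]; ring

end TransductiveGNN

theorem theorem2 :
    -- the constant depends only on the number of parameters and on
    -- `α`, `P_F`, `b_g`, `b_ℓ`, `G`, `σ₀`, `t₀`, in this order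
    ∃ C : ℕ → ℝ → ℝ → ℝ → ℝ → ℝ → ℝ → ℝ → ℝ,
      ∀ (m u : ℕ), 1 ≤ m → 1 ≤ u →
      ∀ (F : TransductiveGNN.Problem (m + u)) (w₁ : F.Param) (r : ℝ), 1 ≤ r →
      ∀ (cX cW α P : ℝ), 0 < cX → 0 < cW → 0 < α → α ≤ 1 → 0 < P →
      F.BoundedFeatures cX → F.BoundedWeights w₁ r cW → F.HolderActivation α P →
      ∀ (t₀ : ℝ), 1 ≤ t₀ →
      ∀ (η : ℕ → ℝ), (∀ t, 1 ≤ t → η t = 1 / ((t : ℝ) + t₀)) →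
      ∀ (T : ℕ), 2 ≤ T →
      ∀ (G σ₀ : ℝ), 0 < G → 0 < σ₀ →
      TransductiveGNN.StaysIn F η w₁ r T →
      TransductiveGNN.BoundedGradients F η w₁ T G →
      TransductiveGNN.BoundedNoise F η w₁ T σ₀ →
      F.IsHolderSmooth α w₁ r (F.holderConst α w₁ r) ∧
      ∀ (δ : ℝ), 0 < δ → δ < 1 →
        1 - δ ≤ TransductiveGNN.prob m u T (fun ω =>
          TransductiveGNN.gradGap F η w₁ ω ≤
            C F.numParams α (F.holderConst α w₁ r) (F.gradBound w₁) (F.lossBound w₁) G σ₀ t₀ *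
              (((m : ℝ) + u) ^ (3 / 2 : ℝ) / ((m : ℝ) * u)) *
              TransductiveGNN.rate α T * Real.log (2 / δ)) := by
  refine ⟨fun d α P bg bl G σ₀ _ => TransductiveGNN.gapConst d α P bg bl G σ₀, ?_⟩
  intro m u hm hu F w₁ r hr cX cW α P _ _ hα hα1 hP _ _ hσ t₀ ht₀ η hη T hT G σ₀ hG _
    hin hgrad hnoise
  have hF := TransductiveGNN.Problem.differentiable_loss hα hα1 hP.le hσ
  have hsm := TransductiveGNN.Problem.isHolderSmooth_holderConst hα hα1 hP.le hσ w₁ r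
  refine ⟨hsm, fun δ hδ hδ1 => TransductiveGNN.one_sub_le_prob hm _ δ ?_⟩
  simp only [not_le]
  exact TransductiveGNN.pr_gradGap_gt hm hu hF hr hα hα1 ht₀ hη hT hG hsm hin hgrad hnoise hδ hδ1
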